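/- **Donoho–Stark principle for the $\tau$-Wigner transform versus the Rihaczek form.** *Setting.* A weight function is a continuous increasing (i.e. non-decreasing) function $\omega:[0,\infty)\to[0,\infty)$ such that ($\alpha$) $\omega(2t)\le K(1+\omega(t))$ for all $t\ge 0$, for some $K\ge 1$; ($\beta$) $\omega(t)=o(t)$ as $t\to\infty$; ($\gamma$) $\omega(t)\ge a+b\log(1+t)$ for all $t\ge0$, for some $a\in\mathbb R$, $b>0$; ($\delta$) $t\mapsto\omega(e^t)$ is convex on $[0,\infty)$. Fix constants $K$, $a$, $b$ for which ($\alpha$) and ($\gamma$) hold. On $\mathbb R^N$ and on $\mathbb R^{2N}$ write $\omega(z):=\omega(|z|)$ with the Euclidean norm. Put $\hat f(\xi)=\int_{\mathbb R^N}e^{-ix\xi}f(x)\,dx$. Let $\mathcal S_\omega(\mathbb R^N)$ be the set of $f\in L^1(\mathbb R^N)$ with $f,\hat f\in C^\infty(\mathbb R^N)$ and $\|e^{\lambda\omega}\partial^\alpha f\|_\infty<\infty$, $\|e^{\lambda\omega}\partial^\alpha\hat f\|_\infty<\infty$ for all $\lambda>0$ and $\alpha\in\mathbb N_0^N$. For $f\in\mathcal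 S_\omega(\mathbb R^N)$ and $\tau\in(0,1)$ put $$Rf(x,\xi)=e^{-ix\xi}f(x)\overline{\hat f(\xi)},\qquad \mathrm{Wig}_\tau(f)(x,\xi)=\int_{\mathbb R^N}e^{-it\xi}f(x+\tau t)\overline{f(x-(1-\tau)t)}\,dt .$$ For $p\in[1,\infty]$ let $p'$ be the conjugate exponent, and let $(2p)'$ be that of $2p$ (so $(2p)'=1$ if $p=\infty$). Norms of functions of $(x,\xi)$ are taken over $\mathbb R^{2N}$. Let $\tilde g(t)=g(-t)$ and, for $\lambda\ge0$ and $\mu>\frac{2N}{b(2p)'}$, $$D^{(3)}_\lambda=\frac{e^{K(1+2K)\lambda}}{(2\pi)^N(\tau-\tau^2)^N},\qquad D^{(2)}_{\lambda,\mu}(g)=\frac{e^{K(1+2K)\lambda}\|e^{K^2\lambda\omega}g\|_\infty\|e^{K^2\lambda\omega}\hat g\|_\infty\|e^{-\mu\omega}\|^2_{L^{(2p)'}(\mathbb R^{2N})}}{(2\pi)^{2N}\|g\|_2^4},$$ $$D^{(4)}_{\lambda,\mu}=\inf_{g\in\mathcal S_\omega(\mathbb R^N),\ g\ne0}\Big[D^{(2)}_{\lambda,\mu}(g)\,e^{2K(K^2\lambda+\mu)}\,\|e^{2K(K^2\lambda+\mu)\omega}\,\mathrm{Wig}_{1-\tau}(\tilde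 g)\|_1\Big].$$ *Statement.* Let $\omega$ be a weight function, $E\subset\mathbb R^{2N}$ a Lebesgue measurable set, $1\le p\le\infty$, $\tau\in(0,1)$ and $\varepsilon\in(0,1)$. Suppose that one of the following conditions holds: (a) there exist $f\in\mathcal S_\omega(\mathbb R^N)$, $f\ne0$, and $\lambda\ge0$ such that $$\int_E e^{\lambda\omega(x,\xi)}|\mathrm{Wig}_\tau(f)(x,\xi)|\,dx\,d\xi\ \ge\ (1-\varepsilon)\sqrt{D^{(3)}_\lambda}\;\|e^{4K^2\lambda\omega}Rf\|_p^{1/2}\,\|e^{4K^2\lambda\omega}Rf\|_{p'}^{1/2};$$ (b) there exist $f\in\mathcal S_\omega(\mathbb R^N)$, $f\ne0$, $\lambda\ge0$ and $\mu>\frac{2N}{b(2p)'}$ such that $$\int_E e^{\lambda\omega(x,\xi)}|Rf(x,\xi)|\,dx\,d\xi\ \ge\ (1-\varepsilon)\,D^{(4)}_{\lambda,\mu}\,\|e^{2K(K^2\lambda+\mu)\omega}\,\mathrm{Wig}_\tau(f)\|_p .$$ Then $m(E)\ge1-\varepsilon$, where $m$ is Lebesgue measure on $\mathbb R^{2N}$.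 -/

import Mathlib

open MeasureTheory
open scoped ENNReal

noncomputable section

namespace TimeFreq

/-- Condition (α) with constant `K`: `K ≥ 1` and `ω(2t) ≤ K (1 + ω(t))` for `t ≥ 0`. -/
def CondAlpha (ω : ℝ → ℝ) (K : ℝ) : Prop :=
  1 ≤ K ∧ ∀ t : ℝ, 0 ≤ t → ω (2 * t) ≤ K * (1 + ω t)

/-- Condition (γ) with constants `a`, `b`: `b > 0` and `ω(t) ≥ a + b log(1 + t)` for `t ≥ 0`. -/
def CondGamma (ω : ℝ → ℝ) (a b : ℝ) : Prop :=
  0 < b ∧ ∀ t : ℝ, 0 ≤ t → a + b * Real.log (1 + t) ≤ ω t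

/-- Weight functions `ω : [0,∞) → [0,∞)` in the sense of Braun, Meise and Taylor.
Only the values of `ω` on `[0,∞)` matter. -/
structure IsWeightFunction (ω : ℝ → ℝ) : Prop where
  nonneg : ∀ t : ℝ, 0 ≤ t → 0 ≤ ω t
  continuousOn : ContinuousOn ω (Set.Ici 0)
  monotoneOn : MonotoneOn ω (Set.Ici 0)
  alpha : ∃ K : ℝ, CondAlpha ω K
  beta : ω =o[Filter.atTop] (fun t : ℝ => t)
  gamma : ∃ a b : ℝ, CondGamma ω a b
  delta : ConvexOn ℝ (Set.Ici 0) (fun t : ℝ => ω (Real.exp t))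

/-- `ℝ^N` with the Euclidean norm and Lebesgue measure. -/
abbrev RN (N : ℕ) : Type := EuclideanSpace ℝ (Fin N)

/-- The phase space `ℝ^{2N} = ℝ^N × ℝ^N`, with its (product) Lebesgue measure. The norm that Lean
puts on this product is the maximum norm and is never used; see `phaseNorm`. -/
abbrev Phase (N : ℕ) : Type := RN N × RN N

variable {N : ℕ}

/-- The Euclidean norm `|(x,ξ)|` on `ℝ^{2N}`. -/
def phaseNorm (z : Phase N) : ℝ := Real.sqrt (‖z.1‖ ^ 2 + ‖z.2‖ ^ 2)

/-- The Fourier transform `f̂(ξ) = ∫ e^{-i x ξ} f(x) dx`. -/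
def fourierT (f : RN N → ℂ) (ξ : RN N) : ℂ :=
  ∫ x : RN N, Complex.exp (-(Complex.I * ((inner ℝ x ξ : ℝ) : ℂ))) * f x

/-- The iterated partial derivative `∂_{i 0} ∂_{i 1} ⋯ ∂_{i (n-1)} f (x)` of a smooth function; these
are all the derivatives `∂^α f` with `|α| = n`. -/
def partialDeriv (f : RN N → ℂ) {n : ℕ} (i : Fin n → Fin N) (x : RN N) : ℂ :=
  iteratedFDeriv ℝ n f x (fun j => EuclideanSpace.single (i j) (1 : ℝ))

/-- `f ∈ 𝒮_ω(ℝ^N)`, the `ω`-ultradifferentiable rapidly decreasing functions of Beurling type. -/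
structure MemS (ω : ℝ → ℝ) (f : RN N → ℂ) : Prop where
  integrable : Integrable f
  smooth : ContDiff ℝ (⊤ : ℕ∞) f
  smooth_fourier : ContDiff ℝ (⊤ : ℕ∞) (fourierT f)
  decay : ∀ lam : ℝ, 0 < lam → ∀ (n : ℕ) (i : Fin n → Fin N), ∃ C : ℝ, ∀ x : RN N,
    Real.exp (lam * ω ‖x‖) * ‖partialDeriv f i x‖ ≤ C
  decay_fourier : ∀ lam : ℝ, 0 < lam → ∀ (n : ℕ) (i : Fin n → Fin N), ∃ C : ℝ, ∀ x : RN N,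
    Real.exp (lam * ω ‖x‖) * ‖partialDeriv (fourierT f) i x‖ ≤ C

/-- The Rihaczek form `Rf(x,ξ) = e^{-i x ξ} f(x) conj(f̂(ξ))`. -/
def rihaczek (f : RN N → ℂ) (z : Phase N) : ℂ :=
  Complex.exp (-(Complex.I * ((inner ℝ z.1 z.2 : ℝ) : ℂ))) * f z.1 *
    (starRingEnd ℂ) (fourierT f z.2)

/-- The `τ`-Wigner transform
`Wig_τ(f)(x,ξ) = ∫ e^{-i t ξ} f(x + τ t) conj(f(x - (1-τ) t)) dt`. -/
def wig (τ : ℝ) (f : RN N → ℂ) (z : Phase N) : ℂ :=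
  ∫ t : RN N, Complex.exp (-(Complex.I * ((inner ℝ t z.2 : ℝ) : ℂ))) *
    f (z.1 + τ • t) * (starRingEnd ℂ) (f (z.1 - (1 - τ) • t))

/-- The reflection `g̃(t) = g(-t)`. -/
def reflect (g : RN N → ℂ) (t : RN N) : ℂ := g (-t)

/-- The weighted norm `‖e^{s ω} h‖_p` over `ℝ^N`, with values in `[0,∞]`. -/
def wNorm (ω : ℝ → ℝ) (s : ℝ) (h : RN N → ℂ) (p : ℝ≥0∞) : ℝ≥0∞ :=
  eLpNorm (fun x : RN N => ((Real.exp (s * ω ‖x‖) : ℝ) : ℂ) * h x) p volume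

/-- The weighted norm `‖e^{s ω} F‖_p` over `ℝ^{2N}`, with values in `[0,∞]`. -/
def wNormPhase (ω : ℝ → ℝ) (s : ℝ) (F : Phase N → ℂ) (p : ℝ≥0∞) : ℝ≥0∞ :=
  eLpNorm (fun z : Phase N => ((Real.exp (s * ω (phaseNorm z)) : ℝ) : ℂ) * F z) p volume

/-- The weighted content `∫_E e^{s ω(x,ξ)} |F(x,ξ)| dx dξ`, with values in `[0,∞]`. -/
def wContent (ω : ℝ → ℝ) (s : ℝ) (F : Phase N → ℂ) (E : Set (Phase N)) : ℝ≥0∞ :=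
  ∫⁻ z in E, ENNReal.ofReal (Real.exp (s * ω (phaseNorm z)) * ‖F z‖)

/-- `D_λ^{(3)} = e^{K(1+2K)λ} / ((2π)^N (τ - τ²)^N)`. -/
def constD3 (N : ℕ) (K τ lam : ℝ) : ℝ :=
  Real.exp (K * (1 + 2 * K) * lam) / ((2 * Real.pi) ^ N * (τ - τ ^ 2) ^ N)

/-- `D_{λ,μ}^{(2)} = e^{K(1+2K)λ} ‖e^{K²λω} g‖_∞ ‖e^{K²λω} ĝ‖_∞ ‖e^{-μω}‖²_{L^{(2p)'}(ℝ^{2N})}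
/ ((2π)^{2N} ‖g‖_2^4)`. -/
def constD2 (ω : ℝ → ℝ) (K : ℝ) (p : ℝ≥0∞) (lam μ : ℝ) (g : RN N → ℂ) : ℝ≥0∞ :=
  ENNReal.ofReal (Real.exp (K * (1 + 2 * K) * lam)) *
      wNorm ω (K ^ 2 * lam) g ∞ * wNorm ω (K ^ 2 * lam) (fourierT g) ∞ *
      (wNormPhase ω (-μ) (fun _ : Phase N => (1 : ℂ)) (ENNReal.conjExponent (2 * p))) ^ 2 /
    (ENNReal.ofReal ((2 * Real.pi) ^ (2 * N)) * (eLpNorm g 2 volume) ^ 4)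

/-- `D_{λ,μ}^{(4)} = inf_{g ∈ 𝒮_ω, g ≠ 0}
D_{λ,μ}^{(2)} e^{2K(K²λ+μ)} ‖e^{2K(K²λ+μ)ω} Wig_{1-τ}(g̃)‖_1`. -/
def constD4 (N : ℕ) (ω : ℝ → ℝ) (K : ℝ) (p : ℝ≥0∞) (τ lam μ : ℝ) : ℝ≥0∞ :=
  ⨅ (g : RN N → ℂ) (_ : MemS ω g) (_ : g ≠ 0),
    constD2 ω K p lam μ g * ENNReal.ofReal (Real.exp (2 * K * (K ^ 2 * lam + μ))) *
      wNormPhase ω (2 * K * (K ^ 2 * lam + μ)) (wig (1 - τ) (reflect g)) 1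

end TimeFreq

end

namespace TimeFreq

variable {N : ℕ}

/-! ### Weight functions: subadditivity up to constants, integrability of negative powers. -/

section Weights

variable {ω : ℝ → ℝ} {K : ℝ}

/-! Both cases rest on one observation (`le_measure_of_le_wContent`): if `e^{λω}|F| ≤ B` everywhere
with `0 < B < ∞`, then the weighted content of `F` on `E` is at most `B · m(E)`, so content at least
`(1-ε)B` forces `m(E) ≥ 1-ε`. What remains is a sup bound with the right `B`, together with its
finiteness and positivity.

Case (a), `F = Wig_τ f`. Condition (α) splits `ω(x,ξ)` into `ω(x)` and `ω(ξ)`. The point `x` is a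
convex combination of the two arguments `x + τt` and `x - (1-τ)t`, so the position weight
distributes over the two copies of `f`, and Cauchy–Schwarz bounds the transform by `∫ |e^{sω} f|²`
(`wig_fst_le`). Parseval rewrites the transform through `f̂`, and the same argument handles the
frequency weight (`wig_snd_le`). Multiplying the two bounds controls the square (`wig_sq_le`) by a
product of an integral in `f` and one in `f̂`. By Tonelli that product is a single integral of a
weighted `|Rf|²`, and Hölder bounds it by the `p` and `p'` norms (`weighted_sq_mul_le`).

Case (b), `F = Rf`. For a window `g`, Fourier inversion bounds `e^{Kλω}|f|` by the weighted `L¹`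
norm of the short-time Fourier transform `V_g f` (`weighted_enorm_le_stft`). Since `V_ĝ f̂` is `V_g
f` rotated in phase space (`enorm_stft_fourier`), `f̂` obeys a bound of the same kind, and the
product bounds `Rf` by the square of that norm (`rihaczek_le_stft`). Hölder against `e^{-μω}` passes
to a weighted `L^{2p}` norm. Finally `|V_g f|²` is dominated by the convolution of `|Wig_τ f|` with
`|Wig_{1-τ} g̃|` (`stft_sq_le_wig`, `wig_reflect`), so Young's inequality with exponents `p` and `1`
finishes (`stft_norm_sq_le`). Taking the infimum over `g` gives `D⁽⁴⁾`, which is finite because `g =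
f` is admissible. -/

theorem IsWeightFunction.le_of_le_add (hω : IsWeightFunction ω) (hK : CondAlpha ω K) {r s t : ℝ}
    (hr : 0 ≤ r) (hs : 0 ≤ s) (ht : 0 ≤ t) (h : r ≤ s + t) :
    ω r ≤ K * (1 + (ω s + ω t)) := by
  have hm : 0 ≤ max s t := le_max_of_le_left hs
  have h1 : ω r ≤ ω (2 * max s t) := by
    refine hω.monotoneOn hr (by simpa using hm) ?_
    linarith [le_max_left s t, le_max_right s t]
  -- Condition (α) is applied at `max s t`, whose weight is at most the sum of the two since `ω ≥
  -- 0`.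
  refine (h1.trans (hK.2 _ hm)).trans ?_
  have hK0 : 0 ≤ K := zero_le_one.trans hK.1
  have : ω (max s t) ≤ ω s + ω t := by
    rcases max_cases s t with ⟨h, -⟩ | ⟨h, -⟩ <;> rw [h] <;>
      linarith [hω.nonneg s hs, hω.nonneg t ht]
  gcongr

/-- Identifies the Euclidean norm with the `L²` product norm, which supplies the triangle inequality
on phase space. -/
theorem phaseNorm_eq (z : Phase N) : phaseNorm z = ‖WithLp.toLp 2 z‖ := by
  rw [WithLp.prod_norm_eq_of_L2]; rfl

theorem phaseNorm_nonneg (z : Phase N) : 0 ≤ phaseNorm z := Real.sqrt_nonneg _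

theorem continuous_phaseNorm : Continuous (phaseNorm : Phase N → ℝ) := by
  unfold phaseNorm; fun_prop

theorem norm_fst_le_phaseNorm (z : Phase N) : ‖z.1‖ ≤ phaseNorm z :=
  Real.le_sqrt_of_sq_le (by nlinarith [sq_nonneg ‖z.2‖])

theorem norm_snd_le_phaseNorm (z : Phase N) : ‖z.2‖ ≤ phaseNorm z :=
  Real.le_sqrt_of_sq_le (by nlinarith [sq_nonneg ‖z.1‖])

theorem norm_le_phaseNorm (z : Phase N) : ‖z‖ ≤ phaseNorm z :=
  max_le (norm_fst_le_phaseNorm z) (norm_snd_le_phaseNorm z)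

theorem phaseNorm_le_add (z : Phase N) : phaseNorm z ≤ ‖z.1‖ + ‖z.2‖ :=
  Real.sqrt_le_iff.2 ⟨by positivity, by nlinarith [norm_nonneg z.1, norm_nonneg z.2]⟩

theorem phaseNorm_add_le (z w : Phase N) : phaseNorm (z + w) ≤ phaseNorm z + phaseNorm w := by
  simp only [phaseNorm_eq, WithLp.toLp_add]
  exact norm_add_le _ _

theorem IsWeightFunction.continuous_norm (hω : IsWeightFunction ω) :
    Continuous fun x : RN N => ω ‖x‖ :=
  hω.continuousOn.comp_continuous _root_.continuous_norm fun x => norm_nonneg x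

theorem IsWeightFunction.continuous_phase (hω : IsWeightFunction ω) :
    Continuous fun z : Phase N => ω (phaseNorm z) :=
  hω.continuousOn.comp_continuous continuous_phaseNorm fun x => phaseNorm_nonneg x

theorem IsWeightFunction.phase_le (hω : IsWeightFunction ω) (hK : CondAlpha ω K) (z : Phase N) :
    ω (phaseNorm z) ≤ K * (1 + (ω ‖z.1‖ + ω ‖z.2‖)) :=
  hω.le_of_le_add hK (phaseNorm_nonneg z) (norm_nonneg _) (norm_nonneg _) (phaseNorm_le_add z)

theorem IsWeightFunction.phase_sub_le (hω : IsWeightFunction ω) (hK : CondAlpha ω K)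
    (z w : Phase N) :
    ω (phaseNorm z) ≤ K * (1 + (ω (phaseNorm w) + ω (phaseNorm (z - w)))) := by
  refine hω.le_of_le_add hK (phaseNorm_nonneg z) (phaseNorm_nonneg _) (phaseNorm_nonneg _) ?_
  simpa using phaseNorm_add_le w (z - w)

theorem IsWeightFunction.norm_sub_le (hω : IsWeightFunction ω) (hK : CondAlpha ω K)
    (x y : RN N) : ω ‖y‖ ≤ K * (1 + (ω ‖x‖ + ω ‖y - x‖)) := by
  refine hω.le_of_le_add hK (norm_nonneg _) (norm_nonneg _) (norm_nonneg _) ?_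
  simpa using norm_add_le x (y - x)

theorem IsWeightFunction.fst_le (hω : IsWeightFunction ω) (z : Phase N) :
    ω ‖z.1‖ ≤ ω (phaseNorm z) :=
  hω.monotoneOn (norm_nonneg _) (phaseNorm_nonneg z) (norm_fst_le_phaseNorm z)

theorem IsWeightFunction.snd_le (hω : IsWeightFunction ω) (z : Phase N) :
    ω ‖z.2‖ ≤ ω (phaseNorm z) :=
  hω.monotoneOn (norm_nonneg _) (phaseNorm_nonneg z) (norm_snd_le_phaseNorm z)

/-- The weight at a convex combination is at most the sum of the weights. -/
theorem IsWeightFunction.convex_comb_le (hω : IsWeightFunction ω) {τ : ℝ}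
    (hτ : τ ∈ Set.Ioo (0 : ℝ) 1) (u v : RN N) :
    ω ‖(1 - τ) • u + τ • v‖ ≤ ω ‖u‖ + ω ‖v‖ := by
  -- A convex combination is no longer than the longer vector, so monotonicity alone suffices and no
  -- factor `K` is lost.
  have h1 : ‖(1 - τ) • u + τ • v‖ ≤ max ‖u‖ ‖v‖ := by
    refine (norm_add_le _ _).trans ?_
    rw [norm_smul, norm_smul, Real.norm_of_nonneg hτ.1.le,
      Real.norm_of_nonneg (by linarith [hτ.2])]
    nlinarith [le_max_left ‖u‖ ‖v‖, le_max_right ‖u‖ ‖v‖, hτ.1, hτ.2]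
  have h2 := hω.monotoneOn (norm_nonneg _) (le_max_of_le_left (norm_nonneg u)) h1
  refine h2.trans ?_
  rcases max_cases ‖u‖ ‖v‖ with ⟨h, -⟩ | ⟨h, -⟩ <;> rw [h] <;>
    linarith [hω.nonneg _ (norm_nonneg u), hω.nonneg _ (norm_nonneg v)]

/-- Condition (γ), exponentiated: the source of all integrability. -/
theorem exp_neg_weight_le {a b s t : ℝ} (hb : CondGamma ω a b) (hs : 0 ≤ s) (ht : 0 ≤ t) :
    Real.exp (-s * ω t) ≤ Real.exp (-s * a) * (1 + t) ^ (-(s * b)) := by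
  rw [Real.rpow_def_of_pos (by linarith), ← Real.exp_add]
  gcongr
  nlinarith [mul_le_mul_of_nonneg_left (hb.2 t ht) hs]

theorem integrable_exp_neg_weight_phase (hω : IsWeightFunction ω) {a b s : ℝ}
    (hb : CondGamma ω a b) (hs0 : 0 ≤ s) (hs : 2 * (N : ℝ) < s * b) :
    Integrable fun z : Phase N => Real.exp (-s * ω (phaseNorm z)) := by
  have hfin : (Module.finrank ℝ (Phase N) : ℝ) < s * b := by
    rw [Module.finrank_prod]; simpa [two_mul] using hs
  have : (volume : Measure (Phase N)).IsAddHaarMeasure :=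
    inferInstanceAs ((volume : Measure (RN N)).prod (volume : Measure (RN N))).IsAddHaarMeasure
  refine ((integrable_one_add_norm hfin).const_mul (Real.exp (-s * a))).mono'
    (Real.continuous_exp.comp
      (continuous_const.mul hω.continuous_phase)).aestronglyMeasurable (Filter.Eventually.of_forall fun z => ?_)
  rw [Real.norm_of_nonneg (Real.exp_pos _).le]
  refine (exp_neg_weight_le hb hs0 (phaseNorm_nonneg z)).trans ?_
  gcongr ?_ * ?_
  -- The integrability criterion uses the maximum norm; it is dominated by the Euclidean one, and
  -- the negative exponent reverses the comparison.
  refine Real.rpow_le_rpow_of_nonpos (by positivity) (by gcongr; exact norm_le_phaseNorm z) ?_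
  have := hb.1
  have : 0 ≤ s * b := by positivity
  linarith

theorem integrable_exp_neg_weight (hω : IsWeightFunction ω) {a b s : ℝ}
    (hb : CondGamma ω a b) (hs0 : 0 ≤ s) (hs : (N : ℝ) < s * b) :
    Integrable fun x : RN N => Real.exp (-s * ω ‖x‖) := by
  have hfin : (Module.finrank ℝ (RN N) : ℝ) < s * b := by simpa using hs
  refine ((integrable_one_add_norm hfin).const_mul (Real.exp (-s * a))).mono'
    (Real.continuous_exp.comp
      (continuous_const.mul hω.continuous_norm)).aestronglyMeasurable (Filter.Eventually.of_forall fun z => ?_)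
  rw [Real.norm_of_nonneg (Real.exp_pos _).le]
  exact exp_neg_weight_le hb hs0 (norm_nonneg z)

/-- A function dominated by every negative power of `e^u` has finite `L^p` norms. -/
theorem eLpNorm_lt_top_of_decay {α : Type*} [MeasurableSpace α] {ν : Measure α} {u : α → ℝ}
    {r : ℝ} (hr : 0 ≤ r) (hu : Integrable (fun z => Real.exp (-r * u z)) ν) {F : α → ℂ}
    (hF : ∀ s : ℝ, 0 ≤ s → ∃ C : ℝ, ∀ z, Real.exp (s * u z) * ‖F z‖ ≤ C) {p : ℝ≥0∞} (hp : p ≠ 0) :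
    eLpNorm F p ν < ∞ := by
  rcases eq_or_ne p ∞ with rfl | hpt
  · obtain ⟨C, hC⟩ := hF 0 le_rfl
    rw [eLpNorm_exponent_top]
    exact eLpNormEssSup_lt_top_of_ae_bound (C := C)
      (Filter.Eventually.of_forall fun z => by simpa using hC z)
  · have hp0 : 0 < p.toReal := ENNReal.toReal_pos hp hpt
    -- Chosen so that the `p`-th power of the decay factor is exactly the integrable `e^{-ru}`.
    obtain ⟨C, hC⟩ := hF (r / p.toReal) (by positivity)
    rw [eLpNorm_lt_top_iff_lintegral_rpow_enorm_lt_top hp hpt]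
    have hle : ∀ z, ‖F z‖ₑ ^ p.toReal ≤ ‖|C| ^ p.toReal * Real.exp (-r * u z)‖ₑ := fun z => by
      have h1 : ‖F z‖ ≤ |C| * Real.exp (-(r / p.toReal) * u z) := by
        have := (hC z).trans (le_abs_self C)
        rw [neg_mul, Real.exp_neg, ← div_eq_mul_inv, le_div_iff₀ (Real.exp_pos _)]
        linarith
      rw [← ofReal_norm, ENNReal.ofReal_rpow_of_nonneg (norm_nonneg _) hp0.le,
        ← ofReal_norm, Real.norm_of_nonneg (by positivity)]
      refine ENNReal.ofReal_le_ofReal ((Real.rpow_le_rpow (norm_nonneg _) h1 hp0.le).trans ?_)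
      rw [Real.mul_rpow (abs_nonneg _) (Real.exp_pos _).le, ← Real.exp_mul]
      refine le_of_eq ?_
      congr 2
      field_simp
    exact (lintegral_mono hle).trans_lt (hu.const_mul (|C| ^ p.toReal)).2

end Weights

end TimeFreq

namespace TimeFreq

variable {N : ℕ}

/-! ### Fourier inversion, Parseval and Plancherel in the non-unitary normalisation. -/

section Fourier

open FourierTransform

theorem norm_char (x ξ : RN N) :
    ‖Complex.exp (-(Complex.I * ((inner ℝ x ξ : ℝ) : ℂ)))‖ = 1 := by
  have : -(Complex.I * ((inner ℝ x ξ : ℝ) : ℂ)) = ((-(inner ℝ x ξ : ℝ) : ℝ) : ℂ) * Complex.I := by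
    push_cast; ring
  rw [this, Complex.norm_exp_ofReal_mul_I]

theorem enorm_char (x ξ : RN N) :
    ‖Complex.exp (-(Complex.I * ((inner ℝ x ξ : ℝ) : ℂ)))‖ₑ = 1 := by
  rw [← ofReal_norm, norm_char, ENNReal.ofReal_one]

theorem conj_char (x ξ : RN N) :
    (starRingEnd ℂ) (Complex.exp (-(Complex.I * ((inner ℝ x ξ : ℝ) : ℂ)))) =
      Complex.exp (Complex.I * ((inner ℝ x ξ : ℝ) : ℂ)) := by
  rw [← Complex.exp_conj]; simp

/-- Rescaling the frequency by `2π` transfers results on `𝓕`, whose kernel is `e^{-2πi x·ξ}`. -/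
theorem fourierT_eq (f : RN N → ℂ) (ξ : RN N) : fourierT f ξ = 𝓕 f ((2 * Real.pi)⁻¹ • ξ) := by
  rw [Real.fourier_eq', fourierT]
  congr 1
  ext x
  rw [smul_eq_mul]
  congr 2
  rw [inner_smul_right]
  have := Real.pi_ne_zero
  have h : -2 * Real.pi * ((2 * Real.pi)⁻¹ * (inner ℝ x ξ : ℝ)) = -(inner ℝ x ξ : ℝ) := by
    field_simp
  rw [h]; push_cast; ring

/-- Fourier inversion for the normalisation of `fourierT`. -/
theorem fourierT_inversion {f : RN N → ℂ} (hf : Integrable f) (hc : Continuous f)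
    (hf' : Integrable (fourierT f)) (y : RN N) :
    ∫ ξ, Complex.exp (Complex.I * ((inner ℝ y ξ : ℝ) : ℂ)) * fourierT f ξ =
      (2 * Real.pi) ^ N * f y := by
  have h2 : (2 * Real.pi : ℝ) ≠ 0 := by positivity
  have h1 : 𝓕 f = fun w => fourierT f ((2 * Real.pi) • w) := by
    ext w; rw [fourierT_eq, smul_smul, inv_mul_cancel₀ h2, one_smul]
  have hF : Integrable (𝓕 f) := by rw [h1]; exact hf'.comp_smul h2
  have h3 := congrFun (hc.fourierInv_fourier_eq hf hF) y
  rw [Real.fourierInv_eq', h1] at h3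
  have h4 := Measure.integral_comp_smul (volume : Measure (RN N))
    (fun ξ => Complex.exp (Complex.I * ((inner ℝ y ξ : ℝ) : ℂ)) * fourierT f ξ) (2 * Real.pi)
  have h5 : (∫ w, Complex.exp (Complex.I * ((inner ℝ y ((2 * Real.pi) • w) : ℝ) : ℂ)) *
      fourierT f ((2 * Real.pi) • w)) = f y := by
    rw [← h3]
    congr 1
    ext w
    rw [smul_eq_mul, inner_smul_right, real_inner_comm]
    congr 2
    push_cast; ring
  rw [h5] at h4
  rw [h4, finrank_euclideanSpace, Fintype.card_fin, abs_of_pos (by positivity), Complex.real_smul]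
  have : ((2 * Real.pi : ℝ) : ℂ) ≠ 0 := by exact_mod_cast h2
  push_cast at this ⊢
  field_simp

theorem continuous_char_left (ξ : RN N) :
    Continuous fun t : RN N => Complex.exp (-(Complex.I * ((inner ℝ t ξ : ℝ) : ℂ))) := by
  fun_prop

theorem continuous_char_prod : Continuous fun z : RN N × RN N =>
    Complex.exp (-(Complex.I * ((inner ℝ z.1 z.2 : ℝ) : ℂ))) := by
  fun_prop

theorem integrable_char_mul {f : RN N → ℂ} (hf : Integrable f) (ξ : RN N) :
    Integrable fun t => Complex.exp (-(Complex.I * ((inner ℝ t ξ : ℝ) : ℂ))) * f t :=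
  hf.bdd_mul (c := 1) (continuous_char_left ξ).aestronglyMeasurable
    (Filter.Eventually.of_forall fun t => (norm_char t ξ).le)

/-- Parseval's formula with a modulation. -/
theorem parseval_modulated {F G : RN N → ℂ} (hF : Integrable F) (hG : Integrable G)
    (hGc : Continuous G) (hG' : Integrable (fourierT G)) (ξ : RN N) :
    ∫ v, fourierT F v * (starRingEnd ℂ) (fourierT G (v - ξ)) =
      (2 * Real.pi) ^ N * ∫ t, Complex.exp (-(Complex.I * ((inner ℝ t ξ : ℝ) : ℂ))) * F t *
        (starRingEnd ℂ) (G t) := by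
  have hGs : Integrable fun v => (starRingEnd ℂ) (fourierT G (v - ξ)) :=
    (Complex.conjLIE.toContinuousLinearEquiv.integrable_comp_iff.2 (hG'.comp_sub_right ξ))
  have hint : Integrable (Function.uncurry fun v t =>
      Complex.exp (-(Complex.I * ((inner ℝ t v : ℝ) : ℂ))) * F t *
        (starRingEnd ℂ) (fourierT G (v - ξ))) (volume.prod volume) := by
    have h1 := (hGs.mul_prod hF).bdd_mul (c := 1)
      (f := fun z : RN N × RN N => Complex.exp (-(Complex.I * ((inner ℝ z.2 z.1 : ℝ) : ℂ))))
      (Continuous.aestronglyMeasurable (by fun_prop))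
      (Filter.Eventually.of_forall fun z => (norm_char z.2 z.1).le)
    refine h1.congr (Filter.Eventually.of_forall fun z => ?_)
    simp only [Function.uncurry]
    ring
  calc ∫ v, fourierT F v * (starRingEnd ℂ) (fourierT G (v - ξ))
      = ∫ v, ∫ t, Complex.exp (-(Complex.I * ((inner ℝ t v : ℝ) : ℂ))) * F t *
          (starRingEnd ℂ) (fourierT G (v - ξ)) := by
        congr 1; ext v; rw [integral_mul_const]; rfl
    _ = ∫ t, ∫ v, Complex.exp (-(Complex.I * ((inner ℝ t v : ℝ) : ℂ))) * F t *
          (starRingEnd ℂ) (fourierT G (v - ξ)) := integral_integral_swap hint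
    _ = ∫ t, (2 * Real.pi) ^ N * (Complex.exp (-(Complex.I * ((inner ℝ t ξ : ℝ) : ℂ))) * F t *
        (starRingEnd ℂ) (G t)) := by
        congr 1; ext t
        -- After the shift `v ↦ v + ξ` the modulation `e^{-itξ}` factors out, and the inner integral
        -- is the conjugate of the inversion formula for `G` at `t`.
        rw [← integral_add_right_eq_self _ ξ]
        have h2 := congrArg (starRingEnd ℂ) (fourierT_inversion hG hGc hG' t)
        rw [← integral_conj] at h2
        have h3 : ∀ v : RN N, Complex.exp (-(Complex.I * ((inner ℝ t (v + ξ) : ℝ) : ℂ))) * F t *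
            (starRingEnd ℂ) (fourierT G (v + ξ - ξ)) =
            (Complex.exp (-(Complex.I * ((inner ℝ t ξ : ℝ) : ℂ))) * F t) *
            (starRingEnd ℂ) (Complex.exp (Complex.I * ((inner ℝ t v : ℝ) : ℂ)) * fourierT G v) := by
          intro v
          rw [map_mul, ← conj_char, Complex.conj_conj, inner_add_right, add_sub_cancel_right]
          push_cast
          rw [mul_add, neg_add, Complex.exp_add]
          ring
        simp_rw [h3]
        rw [integral_const_mul, h2]
        simp only [map_mul, map_pow, Complex.conj_ofReal, map_ofNat]
        ring
    _ = _ := by rw [integral_const_mul]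

/-- Continuous integrable functions decaying, together with their Fourier transforms, faster than
every power of `e^{-ω}`. -/
structure RapidDecay (ω : ℝ → ℝ) (f : RN N → ℂ) : Prop where
  integrable : Integrable f
  continuous : Continuous f
  decay : ∀ s : ℝ, 0 ≤ s → ∃ C : ℝ, ∀ x, Real.exp (s * ω ‖x‖) * ‖f x‖ ≤ C
  integrable_fourier : Integrable (fourierT f)
  continuous_fourier : Continuous (fourierT f)
  decay_fourier : ∀ s : ℝ, 0 ≤ s → ∃ C : ℝ, ∀ x, Real.exp (s * ω ‖x‖) * ‖fourierT f x‖ ≤ C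

theorem decay_of_pos {ω : ℝ → ℝ} (hω : IsWeightFunction ω) {f : RN N → ℂ}
    (h : ∀ lam : ℝ, 0 < lam → ∀ (n : ℕ) (i : Fin n → Fin N), ∃ C : ℝ, ∀ x : RN N,
      Real.exp (lam * ω ‖x‖) * ‖partialDeriv f i x‖ ≤ C) (s : ℝ) (hs : 0 ≤ s) :
    ∃ C : ℝ, ∀ x, Real.exp (s * ω ‖x‖) * ‖f x‖ ≤ C := by
  -- The hypothesis needs a strictly positive exponent while `s` may be `0`; order zero gives `f`
  -- itself.
  obtain ⟨C, hC⟩ := h (s + 1) (by linarith) 0 Fin.elim0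
  refine ⟨C, fun x => le_trans ?_ (hC x)⟩
  have : partialDeriv f Fin.elim0 x = f x := by simp [partialDeriv]
  rw [this]
  have := hω.nonneg _ (norm_nonneg x)
  gcongr
  linarith

theorem weight_exponent_exists {ω : ℝ → ℝ} (hω : IsWeightFunction ω) (N : ℕ) :
    ∃ r : ℝ, 0 ≤ r ∧ (Integrable fun x : RN N => Real.exp (-r * ω ‖x‖)) ∧
      Integrable fun z : Phase N => Real.exp (-r * ω (phaseNorm z)) := by
  obtain ⟨a, b, hb⟩ := hω.gamma
  have hb0 := hb.1
  have h : (2 * (N : ℝ) + 1) / b * b = 2 * (N : ℝ) + 1 := by field_simp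
  refine ⟨(2 * N + 1) / b, by positivity, integrable_exp_neg_weight hω hb (by positivity) ?_,
    integrable_exp_neg_weight_phase hω hb (by positivity) ?_⟩
  · rw [h]; linarith [(Nat.cast_nonneg N : (0 : ℝ) ≤ N)]
  · rw [h]; linarith

/-- The estimates need no derivatives: continuity and zeroth-order decay of `f` and `f̂` suffice.
Integrability of `f̂` follows from its decay. -/
theorem MemS.rapidDecay {ω : ℝ → ℝ} (hω : IsWeightFunction ω) {f : RN N → ℂ} (hf : MemS ω f) :
    RapidDecay ω f where
  integrable := hf.integrable
  continuous := hf.smooth.continuous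
  decay := decay_of_pos hω hf.decay
  integrable_fourier := by
    obtain ⟨r, hr, hi, -⟩ := weight_exponent_exists hω N
    exact memLp_one_iff_integrable.1 ⟨hf.smooth_fourier.continuous.aestronglyMeasurable,
      eLpNorm_lt_top_of_decay hr hi (decay_of_pos hω hf.decay_fourier) one_ne_zero⟩
  continuous_fourier := hf.smooth_fourier.continuous
  decay_fourier := decay_of_pos hω hf.decay_fourier

theorem fourierT_reflect (f : RN N → ℂ) (ξ : RN N) : fourierT (reflect f) ξ = fourierT f (-ξ) := by
  rw [fourierT, fourierT, ← integral_neg_eq_self]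
  simp [reflect]

theorem RapidDecay.reflect {ω : ℝ → ℝ} {f : RN N → ℂ} (hf : RapidDecay ω f) :
    RapidDecay ω (reflect f) := by
  have h : fourierT (TimeFreq.reflect f) = fun ξ => fourierT f (-ξ) := funext (fourierT_reflect f)
  refine ⟨hf.integrable.comp_neg, hf.continuous.comp continuous_neg, fun s hs => ?_,
    h ▸ hf.integrable_fourier.comp_neg, h ▸ hf.continuous_fourier.comp continuous_neg,
    fun s hs => ?_⟩
  · obtain ⟨C, hC⟩ := hf.decay s hs
    exact ⟨C, fun x => by simpa [TimeFreq.reflect] using hC (-x)⟩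
  · obtain ⟨C, hC⟩ := hf.decay_fourier s hs
    exact ⟨C, fun x => by simpa [h] using hC (-x)⟩

/-- Injectivity from inversion; it keeps the sup bounds nonzero, so that they can be cancelled. -/
theorem fourierT_ne_zero {f : RN N → ℂ} (hf : Integrable f) (hc : Continuous f) (h0 : f ≠ 0) :
    fourierT f ≠ 0 := by
  intro h
  refine h0 (funext fun y => ?_)
  have h1 := fourierT_inversion hf hc (by rw [h]; exact integrable_zero _ _ _) y
  simp only [h, Pi.zero_apply, mul_zero, integral_zero] at h1
  have h2 : ((2 : ℂ) * Real.pi) ^ N ≠ 0 := pow_ne_zero _ (by simp [Real.pi_ne_zero])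
  simpa [h2] using h1.symm

theorem RapidDecay.integrable_sq {ω : ℝ → ℝ} {f : RN N → ℂ} (hf : RapidDecay ω f) :
    Integrable fun x => ‖f x‖ ^ 2 := by
  obtain ⟨C, hC⟩ := hf.decay 0 le_rfl
  have := hf.integrable.norm.bdd_mul (c := C) (f := fun x => ‖f x‖)
    hf.continuous.norm.aestronglyMeasurable
    (Filter.Eventually.of_forall fun t => by simpa using hC t)
  simpa [pow_two] using this

theorem RapidDecay.integrable_fourier_sq {ω : ℝ → ℝ} {f : RN N → ℂ} (hf : RapidDecay ω f) :
    Integrable fun x => ‖fourierT f x‖ ^ 2 := by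
  obtain ⟨C, hC⟩ := hf.decay_fourier 0 le_rfl
  have := hf.integrable_fourier.norm.bdd_mul (c := C) (f := fun x => ‖fourierT f x‖)
    hf.continuous_fourier.norm.aestronglyMeasurable
    (Filter.Eventually.of_forall fun t => by simpa using hC t)
  simpa [pow_two] using this

theorem lintegral_enorm_sq_eq {α : Type*} [MeasurableSpace α] {ν : Measure α} {f : α → ℂ}
    (h : Integrable (fun x => ‖f x‖ ^ 2) ν) :
    ∫⁻ x, ‖f x‖ₑ ^ 2 ∂ν = ENNReal.ofReal (∫ x, ‖f x‖ ^ 2 ∂ν) := by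
  rw [ofReal_integral_eq_lintegral_ofReal h (Filter.Eventually.of_forall fun x => by positivity)]
  simp [ENNReal.ofReal_pow]

/-- Plancherel's theorem for rapidly decaying functions. -/
theorem RapidDecay.plancherel {ω : ℝ → ℝ} {f : RN N → ℂ} (hf : RapidDecay ω f) :
    ∫⁻ ξ, ‖fourierT f ξ‖ₑ ^ 2 = ENNReal.ofReal ((2 * Real.pi) ^ N) * ∫⁻ x, ‖f x‖ₑ ^ 2 := by
  have h := parseval_modulated hf.integrable hf.integrable hf.continuous hf.integrable_fourier 0
  have hsq : ∀ z : ℂ, z * (starRingEnd ℂ) z = ((‖z‖ ^ 2 : ℝ) : ℂ) := fun z => by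
    rw [Complex.mul_conj, Complex.normSq_eq_norm_sq]
  simp only [sub_zero, inner_zero_right, Complex.ofReal_zero, mul_zero, neg_zero, Complex.exp_zero,
    one_mul, hsq, integral_complex_ofReal] at h
  rw [lintegral_enorm_sq_eq hf.integrable_fourier_sq, lintegral_enorm_sq_eq hf.integrable_sq,
    ← ENNReal.ofReal_mul (by positivity)]
  congr 1
  exact_mod_cast h

end Fourier

end TimeFreq

/-! ### Extended-valued weights and affine changes of variables. -/

noncomputable section

namespace TimeFreq

variable {N : ℕ}

/-- The weight `e^{s ω(r)}` with values in `[0,∞]`. -/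
def expW (ω : ℝ → ℝ) (s r : ℝ) : ℝ≥0∞ := ENNReal.ofReal (Real.exp (s * ω r))

theorem expW_ne_top (ω : ℝ → ℝ) (s r : ℝ) : expW ω s r ≠ ∞ := ENNReal.ofReal_ne_top

theorem enorm_exp_mul (t : ℝ) (w : ℂ) :
    ‖((Real.exp t : ℝ) : ℂ) * w‖ₑ = ENNReal.ofReal (Real.exp t) * ‖w‖ₑ := by
  rw [enorm_mul, ← ofReal_norm ((Real.exp t : ℝ) : ℂ), Complex.norm_real,
    Real.norm_of_nonneg (Real.exp_pos _).le]

theorem ofReal_exp_mul (s t : ℝ) : ENNReal.ofReal (Real.exp s) * ENNReal.ofReal (Real.exp t) =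
    ENNReal.ofReal (Real.exp (s + t)) := by
  rw [← ENNReal.ofReal_mul (Real.exp_pos _).le, Real.exp_add]

theorem ofReal_exp_mono {s t : ℝ} (h : s ≤ t) :
    ENNReal.ofReal (Real.exp s) ≤ ENNReal.ofReal (Real.exp t) :=
  ENNReal.ofReal_le_ofReal (Real.exp_le_exp.2 h)

theorem IsWeightFunction.measurable_expW_norm {ω : ℝ → ℝ} (hω : IsWeightFunction ω) (s : ℝ) :
    Measurable fun x : RN N => expW ω s ‖x‖ :=
  ENNReal.measurable_ofReal.comp
    (Real.continuous_exp.comp (continuous_const.mul hω.continuous_norm)).measurable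

theorem IsWeightFunction.measurable_expW_phase {ω : ℝ → ℝ} (hω : IsWeightFunction ω) (s : ℝ) :
    Measurable fun z : Phase N => expW ω s (phaseNorm z) :=
  ENNReal.measurable_ofReal.comp
    (Real.continuous_exp.comp (continuous_const.mul hω.continuous_phase)).measurable

theorem lintegral_comp_add_smul {A : RN N → ℝ≥0∞} (hA : Measurable A) (x : RN N) {c : ℝ}
    (hc : c ≠ 0) :
    ∫⁻ t, A (x + c • t) = ENNReal.ofReal ((|c| ^ N)⁻¹) * ∫⁻ t, A t := by
  rw [← lintegral_add_left_eq_self A x,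
    ← lintegral_map (μ := volume) (f := fun t => A (x + t)) (g := fun t : RN N => c • t)
      (hA.comp (measurable_const_add x)) (measurable_const_smul c),
    Measure.map_addHaar_smul volume hc, lintegral_smul_measure, smul_eq_mul]
  simp [abs_inv, abs_pow]

theorem rpow_half_mul_self (I : ℝ≥0∞) : I ^ (1 / 2 : ℝ) * I ^ (1 / 2 : ℝ) = I := by
  rw [← ENNReal.rpow_add_of_nonneg _ _ (by norm_num) (by norm_num)]
  norm_num

/-- Cauchy–Schwarz, then an affine substitution in each factor; the two Jacobians enter with
exponent one half. -/
theorem lintegral_affine_mul_le {A : RN N → ℝ≥0∞} (hA : Measurable A) (x y : RN N) {c d : ℝ}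
    (hc : c ≠ 0) (hd : d ≠ 0) :
    ∫⁻ t, A (x + c • t) * A (y + d • t) ≤
      ENNReal.ofReal ((Real.sqrt (|c| * |d|) ^ N)⁻¹) * ∫⁻ t, A t ^ 2 := by
  have hm : ∀ (x : RN N) (c : ℝ), Measurable fun t : RN N => A (x + c • t) := fun x c =>
    hA.comp ((measurable_const_smul c).const_add x)
  have h := ENNReal.lintegral_mul_le_Lp_mul_Lq (volume : Measure (RN N)) Real.HolderConjugate.two_two
    (hm x c).aemeasurable (hm y d).aemeasurable
  refine h.trans (le_of_eq ?_)
  simp only [ENNReal.rpow_ofNat]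
  rw [lintegral_comp_add_smul (hA.pow_const 2) x hc, lintegral_comp_add_smul (hA.pow_const 2) y hd,
    ENNReal.mul_rpow_of_nonneg _ _ (by norm_num), ENNReal.mul_rpow_of_nonneg _ _ (by norm_num),
    mul_mul_mul_comm, rpow_half_mul_self, ← ENNReal.mul_rpow_of_nonneg _ _ (by norm_num),
    ← ENNReal.ofReal_mul (by positivity), ENNReal.ofReal_rpow_of_nonneg (by positivity)
      (by norm_num)]
  congr 2
  rw [← Real.sqrt_eq_rpow, ← mul_inv, ← mul_pow, Real.sqrt_inv]
  congr 1
  rw [Real.sqrt_eq_iff_mul_self_eq (by positivity) (by positivity), ← mul_pow,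
    Real.mul_self_sqrt (by positivity)]

/-- The translation contributes only a unimodular factor, so the modulus sees just the dilation. -/
theorem enorm_fourierT_comp_affine (f : RN N → ℂ) (x v : RN N) {c : ℝ} (hc : c ≠ 0) :
    ‖fourierT (fun t => f (x + c • t)) v‖ₑ =
      ENNReal.ofReal ((|c| ^ N)⁻¹) * ‖fourierT f (c⁻¹ • v)‖ₑ := by
  have h1 : fourierT (fun t => f (x + c • t)) v =
      ∫ t, (fun u : RN N => Complex.exp (-(Complex.I *
        ((inner ℝ (c⁻¹ • u) v : ℝ) : ℂ))) * f (x + u)) (c • t) := by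
    rw [fourierT]
    congr 1
    ext t
    simp only [smul_smul, inv_mul_cancel₀ hc, one_smul]
  rw [h1, Measure.integral_comp_smul volume (fun u : RN N => Complex.exp (-(Complex.I *
        ((inner ℝ (c⁻¹ • u) v : ℝ) : ℂ))) * f (x + u))]
  have h2 : ∫ u : RN N, Complex.exp (-(Complex.I *
        ((inner ℝ (c⁻¹ • u) v : ℝ) : ℂ))) * f (x + u) =
      Complex.exp (-(Complex.I * ((inner ℝ (-x) (c⁻¹ • v) : ℝ) : ℂ))) * fourierT f (c⁻¹ • v) := by
    conv_rhs => rw [fourierT, ← integral_const_mul, ← integral_add_left_eq_self _ x]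
    congr 1
    ext u
    rw [← mul_assoc, ← Complex.exp_add]
    congr 2
    simp only [inner_add_left, inner_neg_left, inner_smul_left, inner_smul_right]
    simp only [conj_trivial]
    push_cast
    ring
  rw [h2, enorm_smul, enorm_mul, enorm_char, one_mul, finrank_euclideanSpace, Fintype.card_fin]
  congr 1
  rw [← ofReal_norm, Real.norm_of_nonneg (abs_nonneg _), abs_inv, abs_pow]

theorem continuous_fourierT {f : RN N → ℂ} (hf : Integrable f) : Continuous (fourierT f) := by
  refine continuous_of_dominated (bound := fun t => ‖f t‖) (fun v => ?_) (fun v => ?_) hf.norm ?_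
  · exact (integrable_char_mul hf v).aestronglyMeasurable
  · exact Filter.Eventually.of_forall fun t => by rw [norm_mul, norm_char, one_mul]
  · exact Filter.Eventually.of_forall fun t => by fun_prop

/-! ### Weighted sup bounds for the `τ`-Wigner transform. -/

section WignerBounds

variable {ω : ℝ → ℝ} {K τ : ℝ} {f : RN N → ℂ}

theorem RapidDecay.integrable_affine (hf : RapidDecay ω f) (x : RN N) {c : ℝ} (hc : c ≠ 0) :
    Integrable fun t => f (x + c • t) :=
  (hf.integrable.comp_add_left x).comp_smul hc

theorem RapidDecay.integrable_fourier_affine (hf : RapidDecay ω f) (x : RN N) {c : ℝ}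
    (hc : c ≠ 0) : Integrable (fourierT fun t => f (x + c • t)) := by
  have h1 := continuous_fourierT (hf.integrable_affine x hc)
  refine ⟨h1.aestronglyMeasurable, ?_⟩
  rw [HasFiniteIntegral]
  simp_rw [enorm_fourierT_comp_affine f x _ hc]
  have h2 := ((hf.integrable_fourier.comp_smul (inv_ne_zero hc))).2
  rw [lintegral_const_mul' _ _ ENNReal.ofReal_ne_top]
  exact ENNReal.mul_lt_top ENNReal.ofReal_lt_top h2

theorem expW_convex_le (hω : IsWeightFunction ω) (hτ : τ ∈ Set.Ioo (0 : ℝ) 1) {s : ℝ}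
    (hs : 0 ≤ s) {x u v : RN N} (h : x = (1 - τ) • u + τ • v) :
    expW ω s ‖x‖ ≤ expW ω s ‖u‖ * expW ω s ‖v‖ := by
  rw [expW, expW, expW, ofReal_exp_mul, ← mul_add, h]
  exact ofReal_exp_mono (mul_le_mul_of_nonneg_left (hω.convex_comb_le hτ u v) hs)

/-- Bound for the `τ`-Wigner transform weighted in the position variable. -/
theorem RapidDecay.wig_fst_le (hf : RapidDecay ω f) (hω : IsWeightFunction ω)
    (hτ : τ ∈ Set.Ioo (0 : ℝ) 1) {s : ℝ} (hs : 0 ≤ s) (z : Phase N) :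
    expW ω s ‖z.1‖ * ‖wig τ f z‖ₑ ≤ ENNReal.ofReal ((Real.sqrt (τ - τ ^ 2) ^ N)⁻¹) *
      ∫⁻ x, (expW ω s ‖x‖ * ‖f x‖ₑ) ^ 2 := by
  have hA : Measurable fun x : RN N => expW ω s ‖x‖ * ‖f x‖ₑ :=
    (hω.measurable_expW_norm s).mul hf.continuous.enorm.measurable
  have h1 := lintegral_affine_mul_le hA z.1 z.1 hτ.1.ne' (d := -(1 - τ)) (by linarith [hτ.2])
  rw [abs_of_pos hτ.1, abs_neg, abs_of_pos (by linarith [hτ.2]),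
    show τ * (1 - τ) = τ - τ ^ 2 by ring] at h1
  refine le_trans ?_ h1
  calc expW ω s ‖z.1‖ * ‖wig τ f z‖ₑ
      ≤ expW ω s ‖z.1‖ * ∫⁻ t, ‖f (z.1 + τ • t)‖ₑ * ‖f (z.1 + (-(1 - τ)) • t)‖ₑ := by
        gcongr
        refine (enorm_integral_le_lintegral_enorm _).trans (le_of_eq ?_)
        congr 1
        ext t
        rw [enorm_mul, enorm_mul, enorm_char, one_mul, RCLike.enorm_conj, neg_smul, sub_eq_add_neg]
    _ = ∫⁻ t, expW ω s ‖z.1‖ * (‖f (z.1 + τ • t)‖ₑ * ‖f (z.1 + (-(1 - τ)) • t)‖ₑ) :=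
        (lintegral_const_mul' _ _ ENNReal.ofReal_ne_top).symm
    _ ≤ _ := by
        refine lintegral_mono fun t => ?_
        have := expW_convex_le hω hτ hs (x := z.1) (u := z.1 + τ • t)
          (v := z.1 + (-(1 - τ)) • t) (by module)
        refine (mul_le_mul_left this _).trans (le_of_eq ?_)
        ring

/-- Bound for the `τ`-Wigner transform weighted in the frequency variable. -/
theorem RapidDecay.wig_snd_le (hf : RapidDecay ω f) (hω : IsWeightFunction ω)
    (hτ : τ ∈ Set.Ioo (0 : ℝ) 1) {s : ℝ} (hs : 0 ≤ s) (z : Phase N) :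
    expW ω s ‖z.2‖ * ‖wig τ f z‖ₑ ≤
      ENNReal.ofReal (((2 * Real.pi) ^ N * Real.sqrt (τ - τ ^ 2) ^ N)⁻¹) *
      ∫⁻ x, (expW ω s ‖x‖ * ‖fourierT f x‖ₑ) ^ 2 := by
  have hτ' : 0 < 1 - τ := by linarith [hτ.2]
  have hτ0 := hτ.1
  have hA : Measurable fun x : RN N => expW ω s ‖x‖ * ‖fourierT f x‖ₑ :=
    (hω.measurable_expW_norm s).mul hf.continuous_fourier.enorm.measurable
  have h1 := lintegral_affine_mul_le hA 0 ((1 - τ)⁻¹ • z.2) (inv_ne_zero hτ.1.ne')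
    (d := -(1 - τ)⁻¹) (neg_ne_zero.2 (inv_ne_zero hτ'.ne'))
  rw [abs_neg, abs_of_pos (inv_pos.2 hτ.1), abs_of_pos (inv_pos.2 hτ')] at h1
  have hd : -(1 - τ) ≠ 0 := neg_ne_zero.2 hτ'.ne'
  have h2 := parseval_modulated (hf.integrable_affine z.1 hτ.1.ne') (hf.integrable_affine z.1 hd)
    (hf.continuous.comp (by fun_prop)) (hf.integrable_fourier_affine z.1 hd) z.2
  have hw : wig τ f z = ∫ t, Complex.exp (-(Complex.I * ((inner ℝ t z.2 : ℝ) : ℂ))) *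
      f (z.1 + τ • t) * (starRingEnd ℂ) (f (z.1 + (-(1 - τ)) • t)) := by
    rw [wig]; simp only [neg_smul, sub_eq_add_neg]
  rw [← hw] at h2
  -- Parseval for the two dilated copies of `f`; their transforms are `f̂` at `v/τ` and at
  -- `(ξ-v)/(1-τ)`, up to unimodular factors and Jacobians.
  have h3 : ENNReal.ofReal ((2 * Real.pi) ^ N) * ‖wig τ f z‖ₑ ≤
      ENNReal.ofReal ((τ ^ N * (1 - τ) ^ N)⁻¹) * ∫⁻ v, ‖fourierT f (0 + τ⁻¹ • v)‖ₑ *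
        ‖fourierT f ((1 - τ)⁻¹ • z.2 + (-(1 - τ)⁻¹) • v)‖ₑ := by
    have h4 : ENNReal.ofReal ((2 * Real.pi) ^ N) = ‖((2 : ℂ) * Real.pi) ^ N‖ₑ := by
      rw [← ofReal_norm]; simp [abs_of_pos Real.pi_pos]
    rw [h4, ← enorm_mul, ← h2, ← lintegral_const_mul' _ _ ENNReal.ofReal_ne_top]
    refine (enorm_integral_le_lintegral_enorm _).trans (le_of_eq ?_)
    congr 1
    ext v
    rw [enorm_mul, RCLike.enorm_conj, enorm_fourierT_comp_affine _ _ _ hτ.1.ne',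
      enorm_fourierT_comp_affine _ _ _ hd, mul_mul_mul_comm, ← ENNReal.ofReal_mul (by positivity),
      abs_neg, abs_of_pos hτ', abs_of_pos hτ0, ← mul_inv, zero_add]
    congr 4
    rw [inv_neg]
    module
  have h5 : expW ω s ‖z.2‖ * ∫⁻ v, ‖fourierT f (0 + τ⁻¹ • v)‖ₑ *
        ‖fourierT f ((1 - τ)⁻¹ • z.2 + (-(1 - τ)⁻¹) • v)‖ₑ ≤
      ENNReal.ofReal ((Real.sqrt (τ⁻¹ * (1 - τ)⁻¹) ^ N)⁻¹) *
        ∫⁻ x, (expW ω s ‖x‖ * ‖fourierT f x‖ₑ) ^ 2 := by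
    refine le_trans ?_ h1
    rw [← lintegral_const_mul' _ _ (expW_ne_top ω s _)]
    refine lintegral_mono fun v => ?_
    -- Again a convex combination: `ξ = (1-τ)·(ξ-v)/(1-τ) + τ·v/τ`.
    have := expW_convex_le hω hτ hs (x := z.2) (v := 0 + τ⁻¹ • v)
      (u := (1 - τ)⁻¹ • z.2 + (-(1 - τ)⁻¹) • v) (by
        simp only [zero_add, smul_add, smul_smul, mul_neg, mul_inv_cancel₀ hτ'.ne',
          mul_inv_cancel₀ hτ0.ne']
        module)
    refine (mul_le_mul_left this _).trans (le_of_eq ?_)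
    ring
  have hpi : (0 : ℝ) < (2 * Real.pi) ^ N := by positivity
  have hs0 : 0 < τ - τ ^ 2 := by nlinarith
  have hsq : 0 < Real.sqrt (τ - τ ^ 2) := Real.sqrt_pos.2 hs0
  have h6 : ‖wig τ f z‖ₑ = ENNReal.ofReal (((2 * Real.pi) ^ N)⁻¹) *
      (ENNReal.ofReal ((2 * Real.pi) ^ N) * ‖wig τ f z‖ₑ) := by
    rw [← mul_assoc, ← ENNReal.ofReal_mul (by positivity), inv_mul_cancel₀ hpi.ne',
      ENNReal.ofReal_one, one_mul]
  rw [h6]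
  calc _ ≤ expW ω s ‖z.2‖ * (ENNReal.ofReal (((2 * Real.pi) ^ N)⁻¹) *
        (ENNReal.ofReal ((τ ^ N * (1 - τ) ^ N)⁻¹) * ∫⁻ v, ‖fourierT f (0 + τ⁻¹ • v)‖ₑ *
        ‖fourierT f ((1 - τ)⁻¹ • z.2 + (-(1 - τ)⁻¹) • v)‖ₑ)) := by gcongr
    _ = ENNReal.ofReal (((2 * Real.pi) ^ N)⁻¹) * ENNReal.ofReal ((τ ^ N * (1 - τ) ^ N)⁻¹) *
        (expW ω s ‖z.2‖ * ∫⁻ v, ‖fourierT f (0 + τ⁻¹ • v)‖ₑ *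
        ‖fourierT f ((1 - τ)⁻¹ • z.2 + (-(1 - τ)⁻¹) • v)‖ₑ) := by ring
    _ ≤ ENNReal.ofReal (((2 * Real.pi) ^ N)⁻¹) * ENNReal.ofReal ((τ ^ N * (1 - τ) ^ N)⁻¹) *
        (ENNReal.ofReal ((Real.sqrt (τ⁻¹ * (1 - τ)⁻¹) ^ N)⁻¹) *
        ∫⁻ x, (expW ω s ‖x‖ * ‖fourierT f x‖ₑ) ^ 2) := by gcongr
    _ = _ := by
        rw [← mul_assoc, ← ENNReal.ofReal_mul (by positivity), ← ENNReal.ofReal_mul (by positivity)]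
        congr 2
        have h7 : τ⁻¹ * (1 - τ)⁻¹ = (τ - τ ^ 2)⁻¹ := by rw [← mul_inv]; congr 1; ring
        have h8 : τ ^ N * (1 - τ) ^ N = Real.sqrt (τ - τ ^ 2) ^ N * Real.sqrt (τ - τ ^ 2) ^ N := by
          rw [← mul_pow, ← mul_pow, Real.mul_self_sqrt hs0.le]; congr 1; ring
        rw [h7, h8, Real.sqrt_inv, inv_pow, inv_inv]
        have h9 : Real.sqrt (τ - τ ^ 2) ^ N ≠ 0 := (pow_pos hsq N).ne'
        generalize Real.sqrt (τ - τ ^ 2) ^ N = q at h9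
        field_simp

end WignerBounds

end TimeFreq
end

noncomputable section

namespace TimeFreq

variable {N : ℕ}

/-! ### Case (a): the Wigner transform bounded by the Rihaczek form. -/

section Uncertainty

variable {ω : ℝ → ℝ} {K τ : ℝ} {f : RN N → ℂ}

theorem expW_phase_le (hω : IsWeightFunction ω) (hK : CondAlpha ω K) {s : ℝ} (hs : 0 ≤ s)
    (z : Phase N) : expW ω s (phaseNorm z) ≤
      ENNReal.ofReal (Real.exp (K * s)) * (expW ω (K * s) ‖z.1‖ * expW ω (K * s) ‖z.2‖) := by
  simp only [expW, ofReal_exp_mul]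
  refine ofReal_exp_mono ?_
  have := mul_le_mul_of_nonneg_left (hω.phase_le hK z) hs
  linarith

theorem expW_sq (ω : ℝ → ℝ) (s r : ℝ) : expW ω s r ^ 2 = expW ω (2 * s) r := by
  rw [pow_two, expW, expW, ofReal_exp_mul]; congr 2; ring

/-- Splitting the phase-space weight leaves `e^{2Kλω(x)} e^{2Kλω(ξ)} |Wig|²`; each weight takes one
factor `|Wig|`, to which the position or frequency bound applies. -/
theorem RapidDecay.wig_sq_le (hf : RapidDecay ω f) (hω : IsWeightFunction ω) (hK : CondAlpha ω K)
    (hτ : τ ∈ Set.Ioo (0 : ℝ) 1) {lam : ℝ} (hl : 0 ≤ lam) (z : Phase N) :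
    (expW ω lam (phaseNorm z) * ‖wig τ f z‖ₑ) ^ 2 ≤ ENNReal.ofReal (constD3 N K τ lam) *
      ((∫⁻ x, (expW ω (2 * (K * lam)) ‖x‖ * ‖f x‖ₑ) ^ 2) *
        ∫⁻ x, (expW ω (2 * (K * lam)) ‖x‖ * ‖fourierT f x‖ₑ) ^ 2) := by
  have hK0 : 0 ≤ K := zero_le_one.trans hK.1
  have hs : 0 ≤ 2 * (K * lam) := by positivity
  have hs0 : 0 < τ - τ ^ 2 := by nlinarith [hτ.1, hτ.2]
  have h1 := hf.wig_fst_le hω hτ hs z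
  have h2 := hf.wig_snd_le hω hτ hs z
  set A := ∫⁻ x, (expW ω (2 * (K * lam)) ‖x‖ * ‖f x‖ₑ) ^ 2
  set B := ∫⁻ x, (expW ω (2 * (K * lam)) ‖x‖ * ‖fourierT f x‖ₑ) ^ 2
  calc (expW ω lam (phaseNorm z) * ‖wig τ f z‖ₑ) ^ 2
      ≤ (ENNReal.ofReal (Real.exp (K * lam)) * (expW ω (K * lam) ‖z.1‖ * expW ω (K * lam) ‖z.2‖)
          * ‖wig τ f z‖ₑ) ^ 2 := by
        gcongr; exact expW_phase_le hω hK hl z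
    _ = ENNReal.ofReal (Real.exp (K * lam)) ^ 2 * ((expW ω (2 * (K * lam)) ‖z.1‖ * ‖wig τ f z‖ₑ) *
          (expW ω (2 * (K * lam)) ‖z.2‖ * ‖wig τ f z‖ₑ)) := by
        rw [← expW_sq, ← expW_sq]; ring
    _ ≤ ENNReal.ofReal (Real.exp (K * (1 + 2 * K) * lam)) *
          ((ENNReal.ofReal ((Real.sqrt (τ - τ ^ 2) ^ N)⁻¹) * A) *
          (ENNReal.ofReal (((2 * Real.pi) ^ N * Real.sqrt (τ - τ ^ 2) ^ N)⁻¹) * B)) := by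
        gcongr
        -- The argument produces only `e^{2Kλ}`; `K ≥ 1` absorbs it into `e^{K(1+2K)λ}`.
        rw [pow_two, ofReal_exp_mul]
        refine ofReal_exp_mono ?_
        nlinarith [mul_nonneg (mul_nonneg hK0 hl) (sub_nonneg.2 hK.1), mul_nonneg hK0 hl]
    _ = _ := by
        rw [mul_mul_mul_comm, ← ENNReal.ofReal_mul (by positivity), ← mul_assoc,
          ← ENNReal.ofReal_mul (Real.exp_pos _).le, constD3]
        congr 2
        rw [div_eq_mul_inv]
        congr 1
        rw [← mul_inv]
        congr 1
        have : (τ - τ ^ 2) ^ N = Real.sqrt (τ - τ ^ 2) ^ N * Real.sqrt (τ - τ ^ 2) ^ N := by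
          rw [← mul_pow, Real.mul_self_sqrt hs0.le]
        rw [this]; ring

theorem weighted_sq_lt_top (hω : IsWeightFunction ω) {h : RN N → ℂ}
    (hd : ∀ s : ℝ, 0 ≤ s → ∃ C : ℝ, ∀ x, Real.exp (s * ω ‖x‖) * ‖h x‖ ≤ C) {s : ℝ} (hs : 0 ≤ s) :
    ∫⁻ x, (expW ω s ‖x‖ * ‖h x‖ₑ) ^ 2 < ∞ := by
  obtain ⟨r, hr, hi, -⟩ := weight_exponent_exists hω N
  have h1 := eLpNorm_lt_top_of_decay (u := fun x : RN N => ω ‖x‖) hr hi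
    (F := fun x => ((Real.exp (s * ω ‖x‖) : ℝ) : ℂ) * h x) (fun t ht => by
      obtain ⟨C, hC⟩ := hd (t + s) (by positivity)
      refine ⟨C, fun x => le_of_eq_of_le ?_ (hC x)⟩
      rw [norm_mul, Complex.norm_real, Real.norm_of_nonneg (Real.exp_pos _).le, ← mul_assoc,
        ← Real.exp_add, add_mul]) (p := 2) (by norm_num)
  rw [eLpNorm_lt_top_iff_lintegral_rpow_enorm_lt_top (by norm_num) (by norm_num)] at h1
  simp only [enorm_exp_mul, ENNReal.toReal_ofNat, ENNReal.rpow_ofNat] at h1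
  exact h1

theorem weighted_sq_ne_zero (hω : IsWeightFunction ω) {h : RN N → ℂ} (hc : Continuous h)
    (h0 : h ≠ 0) (s : ℝ) : ∫⁻ x, (expW ω s ‖x‖ * ‖h x‖ₑ) ^ 2 ≠ 0 := by
  intro hz
  have hm : Measurable fun x => (expW ω s ‖x‖ * ‖h x‖ₑ) ^ 2 :=
    ((hω.measurable_expW_norm s).mul hc.enorm.measurable).pow_const 2
  rw [lintegral_eq_zero_iff hm] at hz
  refine h0 ((hc.ae_eq_iff_eq volume continuous_zero).1 ?_)
  filter_upwards [hz] with x hx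
  have h1 : expW ω s ‖x‖ ≠ 0 := by simp [expW, Real.exp_pos]
  simpa [h1] using hx

/-- The quantitative bound read qualitatively; it gives finiteness of the weighted Wigner norms and,
later, integrability in the frequency variable. -/
theorem RapidDecay.wig_decay (hf : RapidDecay ω f) (hω : IsWeightFunction ω)
    (hτ : τ ∈ Set.Ioo (0 : ℝ) 1) (s : ℝ) (hs : 0 ≤ s) :
    ∃ C : ℝ, ∀ z : Phase N, Real.exp (s * ω (phaseNorm z)) * ‖wig τ f z‖ ≤ C := by
  obtain ⟨K, hK⟩ := hω.alpha
  have hK0 : 0 ≤ K := zero_le_one.trans hK.1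
  have hs' : 0 ≤ 2 * (K * s) := by positivity
  have hB := ENNReal.mul_lt_top (weighted_sq_lt_top hω hf.decay hs')
    (weighted_sq_lt_top hω hf.decay_fourier hs')
  have hB' := ENNReal.mul_lt_top (ENNReal.ofReal_lt_top (r := constD3 N K τ s)) hB
  set B := ENNReal.ofReal (constD3 N K τ s) * ((∫⁻ x, (expW ω (2 * (K * s)) ‖x‖ * ‖f x‖ₑ) ^ 2) *
        ∫⁻ x, (expW ω (2 * (K * s)) ‖x‖ * ‖fourierT f x‖ₑ) ^ 2) with hBdef
  refine ⟨Real.sqrt B.toReal, fun z => Real.le_sqrt_of_sq_le ?_⟩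
  have h1 := hf.wig_sq_le hω hK hτ hs z
  rw [← hBdef] at h1
  have h2 := ENNReal.toReal_mono hB'.ne h1
  simpa [expW, ENNReal.toReal_ofReal (Real.exp_pos _).le] using h2

theorem continuous_weight_mul (hω : IsWeightFunction ω) (s : ℝ) :
    Continuous fun z : Phase N => ((Real.exp (s * ω (phaseNorm z)) : ℝ) : ℂ) :=
  Complex.continuous_ofReal.comp
    (Real.continuous_exp.comp (continuous_const.mul hω.continuous_phase))

theorem wNormPhase_lt_top (hω : IsWeightFunction ω) {F : Phase N → ℂ}
    (hd : ∀ s : ℝ, 0 ≤ s → ∃ C : ℝ, ∀ z, Real.exp (s * ω (phaseNorm z)) * ‖F z‖ ≤ C)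
    {s : ℝ} (hs : 0 ≤ s) {p : ℝ≥0∞} (hp : p ≠ 0) : wNormPhase ω s F p < ∞ := by
  obtain ⟨r, hr, -, hi⟩ := weight_exponent_exists hω N
  refine eLpNorm_lt_top_of_decay (u := fun x : Phase N => ω (phaseNorm x)) hr hi
    (fun t ht => ?_) hp
  obtain ⟨C, hC⟩ := hd (t + s) (by positivity)
  refine ⟨C, fun x => le_of_eq_of_le ?_ (hC x)⟩
  rw [norm_mul, Complex.norm_real, Real.norm_of_nonneg (Real.exp_pos _).le, ← mul_assoc,
    ← Real.exp_add, add_mul]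

theorem RapidDecay.continuous_rihaczek (hf : RapidDecay ω f) : Continuous (rihaczek f) := by
  have h1 := hf.continuous
  have h2 := hf.continuous_fourier
  unfold rihaczek
  exact ((continuous_char_prod (N := N)).mul (h1.comp continuous_fst)).mul
    (Complex.continuous_conj.comp (h2.comp continuous_snd))

theorem norm_rihaczek (f : RN N → ℂ) (z : Phase N) :
    ‖rihaczek f z‖ = ‖f z.1‖ * ‖fourierT f z.2‖ := by
  rw [rihaczek, norm_mul, norm_mul, norm_char, one_mul, RCLike.norm_conj]

theorem enorm_rihaczek (f : RN N → ℂ) (z : Phase N) :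
    ‖rihaczek f z‖ₑ = ‖f z.1‖ₑ * ‖fourierT f z.2‖ₑ := by
  rw [← ofReal_norm, norm_rihaczek, ENNReal.ofReal_mul (norm_nonneg _), ofReal_norm, ofReal_norm]

theorem RapidDecay.rihaczek_decay (hf : RapidDecay ω f) (hω : IsWeightFunction ω) (s : ℝ)
    (hs : 0 ≤ s) :
    ∃ C : ℝ, ∀ z : Phase N, Real.exp (s * ω (phaseNorm z)) * ‖rihaczek f z‖ ≤ C := by
  obtain ⟨K, hK⟩ := hω.alpha
  have hK0 : 0 ≤ K := zero_le_one.trans hK.1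
  obtain ⟨C₁, h₁⟩ := hf.decay (K * s) (by positivity)
  obtain ⟨C₂, h₂⟩ := hf.decay_fourier (K * s) (by positivity)
  refine ⟨Real.exp (K * s) * (C₁ * C₂), fun z => ?_⟩
  have h3 : Real.exp (s * ω (phaseNorm z)) ≤
      Real.exp (K * s) * (Real.exp (K * s * ω ‖z.1‖) * Real.exp (K * s * ω ‖z.2‖)) := by
    rw [← Real.exp_add, ← Real.exp_add]
    have := mul_le_mul_of_nonneg_left (hω.phase_le hK z) hs
    gcongr
    linarith
  have h4 : 0 ≤ C₁ := le_trans (by positivity) (h₁ 0)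
  rw [norm_rihaczek]
  calc _ ≤ Real.exp (K * s) * (Real.exp (K * s * ω ‖z.1‖) * Real.exp (K * s * ω ‖z.2‖)) *
        (‖f z.1‖ * ‖fourierT f z.2‖) := by gcongr
    _ = Real.exp (K * s) * ((Real.exp (K * s * ω ‖z.1‖) * ‖f z.1‖) *
        (Real.exp (K * s * ω ‖z.2‖) * ‖fourierT f z.2‖)) := by ring
    _ ≤ _ := by gcongr <;> simp_all

/-- `|Rf(x,ξ)| = |f(x)||f̂(ξ)|`, so the product is one phase-space integral of a weighted `|Rf|²`.
Both `ω(x)` and `ω(ξ)` are at most `ω(x,ξ)`, whence `2s ≤ t`; Hölder is applied to the weighted form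
times itself. -/
theorem RapidDecay.weighted_sq_mul_le (hf : RapidDecay ω f) (hω : IsWeightFunction ω) {s t : ℝ}
    (hs : 0 ≤ s) (hst : 2 * s ≤ t) {p q : ℝ≥0∞} (hpq : p.HolderConjugate q) :
    (∫⁻ x, (expW ω s ‖x‖ * ‖f x‖ₑ) ^ 2) * (∫⁻ x, (expW ω s ‖x‖ * ‖fourierT f x‖ₑ) ^ 2) ≤
      wNormPhase ω t (rihaczek f) p * wNormPhase ω t (rihaczek f) q := by
  have hm : AEStronglyMeasurable (fun z : Phase N =>
      ((Real.exp (t * ω (phaseNorm z)) : ℝ) : ℂ) * rihaczek f z) volume :=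
    ((continuous_weight_mul hω t).mul hf.continuous_rihaczek).aestronglyMeasurable
  have h1 := eLpNorm_smul_le_mul_eLpNorm (r := 1) (p := p) (q := q) hm hm
  refine le_trans ?_ h1
  have hA : AEMeasurable (fun x : RN N => (expW ω s ‖x‖ * ‖f x‖ₑ) ^ 2) volume :=
    (((hω.measurable_expW_norm s).mul hf.continuous.enorm.measurable).pow_const 2).aemeasurable
  have hB : AEMeasurable (fun x : RN N => (expW ω s ‖x‖ * ‖fourierT f x‖ₑ) ^ 2) volume :=
    (((hω.measurable_expW_norm s).mul
      hf.continuous_fourier.enorm.measurable).pow_const 2).aemeasurable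
  rw [← lintegral_prod_mul hA hB, eLpNorm_one_eq_lintegral_enorm]
  refine lintegral_mono fun z => ?_
  rw [Pi.smul_apply', smul_eq_mul, enorm_mul, ← mul_pow, ← pow_two]
  refine pow_le_pow_left' ?_ 2
  rw [enorm_exp_mul, enorm_rihaczek, mul_mul_mul_comm]
  gcongr
  rw [expW, expW, ofReal_exp_mul]
  refine ofReal_exp_mono ?_
  have h1 := mul_le_mul_of_nonneg_left (hω.fst_le z) hs
  have h2 := mul_le_mul_of_nonneg_left (hω.snd_le z) hs
  have h3 := mul_le_mul_of_nonneg_right hst (hω.nonneg _ (phaseNorm_nonneg z))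
  linarith

/-- A set carrying a proportion `1 - ε` of a sup-norm bound has measure at least `1 - ε`. -/
theorem le_measure_of_le_wContent {F : Phase N → ℂ} {s : ℝ} {E : Set (Phase N)} {c B : ℝ≥0∞}
    (hF : ∀ z, expW ω s (phaseNorm z) * ‖F z‖ₑ ≤ B) (h0 : B ≠ 0) (ht : B ≠ ∞)
    (h : c * B ≤ wContent ω s F E) : c ≤ volume E := by
  have h1 : wContent ω s F E ≤ B * volume E := by
    rw [wContent, ← setLIntegral_const]
    refine lintegral_mono fun z => ?_
    rw [ENNReal.ofReal_mul (Real.exp_pos _).le, ofReal_norm]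
    exact hF z
  rw [mul_comm] at h
  exact (ENNReal.mul_le_mul_iff_right h0 ht).1 (h.trans h1)

theorem measure_ge_of_wig (hω : IsWeightFunction ω) (hK : CondAlpha ω K) (hf : RapidDecay ω f)
    (hf0 : f ≠ 0) (hτ : τ ∈ Set.Ioo (0 : ℝ) 1) {lam : ℝ} (hl : 0 ≤ lam) {E : Set (Phase N)}
    {p : ℝ≥0∞} (hp : 1 ≤ p) {c : ℝ≥0∞}
    (h : c * ENNReal.ofReal (Real.sqrt (constD3 N K τ lam)) *
      wNormPhase ω (4 * K ^ 2 * lam) (rihaczek f) p ^ (1 / 2 : ℝ) *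
      wNormPhase ω (4 * K ^ 2 * lam) (rihaczek f) (ENNReal.conjExponent p) ^ (1 / 2 : ℝ) ≤
        wContent ω lam (wig τ f) E) : c ≤ volume E := by
  have hpq : p.HolderConjugate (ENNReal.conjExponent p) := .conjExponent hp
  have hK0 : 0 ≤ K := zero_le_one.trans hK.1
  have hs : 0 ≤ 2 * (K * lam) := by positivity
  have hs4 : 0 ≤ 4 * K ^ 2 * lam := by positivity
  have hs0 : 0 < τ - τ ^ 2 := by nlinarith [hτ.1, hτ.2]
  have hD : 0 < constD3 N K τ lam := by unfold constD3; positivity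
  -- The estimates need exponent `4Kλ`; `K ≥ 1` passes to `4K²λ`.
  have hst : 2 * (2 * (K * lam)) ≤ 4 * K ^ 2 * lam := by
    nlinarith [mul_nonneg (mul_nonneg hK0 hl) (sub_nonneg.2 hK.1)]
  have hfin : ∀ {r : ℝ≥0∞}, r ≠ 0 → wNormPhase ω (4 * K ^ 2 * lam) (rihaczek f) r < ∞ :=
    fun hr => wNormPhase_lt_top hω (hf.rihaczek_decay hω) hs4 hr
  have hle := hf.weighted_sq_mul_le hω hs hst hpq
  have hne := mul_ne_zero (weighted_sq_ne_zero hω hf.continuous hf0 (2 * (K * lam)))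
    (weighted_sq_ne_zero hω hf.continuous_fourier
      (fourierT_ne_zero hf.integrable hf.continuous hf0) (2 * (K * lam)))
  have hPt := (hfin (zero_lt_one.trans_le hp).ne').ne
  have hQt := (hfin (ENNReal.HolderConjugate.ne_zero (ENNReal.conjExponent p) p)).ne
  set P := wNormPhase ω (4 * K ^ 2 * lam) (rihaczek f) p
  set Q := wNormPhase ω (4 * K ^ 2 * lam) (rihaczek f) (ENNReal.conjExponent p)
  -- `PQ` dominates a product of weighted integrals that is nonzero because `f` and `f̂` are
  -- continuous and nonzero.
  have hPQ : P * Q ≠ 0 := fun h0 => hne (le_antisymm (h0 ▸ hle) zero_le)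
  have hB : ENNReal.ofReal (Real.sqrt (constD3 N K τ lam)) * P ^ (1 / 2 : ℝ) * Q ^ (1 / 2 : ℝ) =
      (ENNReal.ofReal (constD3 N K τ lam) * (P * Q)) ^ (1 / 2 : ℝ) := by
    rw [ENNReal.mul_rpow_of_nonneg _ _ (by norm_num), ENNReal.mul_rpow_of_nonneg _ _ (by norm_num),
      ENNReal.ofReal_rpow_of_nonneg hD.le (by norm_num), ← Real.sqrt_eq_rpow, mul_assoc]
  refine le_measure_of_le_wContent
    (B := (ENNReal.ofReal (constD3 N K τ lam) * (P * Q)) ^ (1 / 2 : ℝ)) (fun z => ?_) ?_ ?_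
    (le_trans (le_of_eq ?_) h)
  · have h1 := (hf.wig_sq_le hω hK hτ hl z).trans (mul_le_mul_right hle _)
    have h2 := ENNReal.rpow_le_rpow h1 (by norm_num : (0 : ℝ) ≤ 1 / 2)
    rwa [← ENNReal.rpow_natCast, ← ENNReal.rpow_mul,
      show ((2 : ℕ) : ℝ) * (1 / 2) = 1 by norm_num, ENNReal.rpow_one] at h2
  · refine (ENNReal.rpow_pos (pos_iff_ne_zero.2 (mul_ne_zero ?_ hPQ)) ?_).ne'
    · exact (ENNReal.ofReal_pos.2 hD).ne'
    · exact ENNReal.mul_ne_top ENNReal.ofReal_ne_top (ENNReal.mul_ne_top hPt hQt)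
  · exact ENNReal.rpow_ne_top_of_nonneg (by norm_num)
      (ENNReal.mul_ne_top ENNReal.ofReal_ne_top (ENNReal.mul_ne_top hPt hQt))
  · rw [← hB, mul_assoc, mul_assoc, mul_assoc]

end Uncertainty

end TimeFreq
end

noncomputable section

namespace TimeFreq

variable {N : ℕ}

/-! ### Young's inequality. -/

section Convolution

variable {G : Type*} [MeasurableSpace G] [AddCommGroup G] [MeasurableAdd₂ G] [MeasurableNeg G]
  {ν : Measure G} [SFinite ν] [ν.IsAddLeftInvariant] [ν.IsNegInvariant]

/-- Young's convolution inequality with exponents `p` and `1`. -/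
theorem eLpNorm_lintegral_conv_le {A B : G → ℝ≥0∞} (hA : Measurable A) (hB : Measurable B)
    {p : ℝ≥0∞} (hp : 1 ≤ p) :
    eLpNorm (fun z => ∫⁻ w, A w * B (z - w) ∂ν) p ν ≤ eLpNorm A p ν * ∫⁻ w, B w ∂ν := by
  have hBz : ∀ z, Measurable fun w => B (z - w) := fun z => hB.comp (measurable_id.const_sub z)
  rcases eq_or_ne p ∞ with rfl | hpt
  · simp only [eLpNorm_exponent_top]
    refine eLpNormEssSup_le_of_ae_enorm_bound (Filter.Eventually.of_forall fun z => ?_)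
    rw [enorm_eq_self, ← lintegral_sub_left_eq_self (μ := ν) B z, ← lintegral_const_mul _ (hBz z)]
    refine lintegral_mono_ae ?_
    filter_upwards [enorm_ae_le_eLpNormEssSup A ν] with w hw
    rw [enorm_eq_self] at hw
    gcongr
  · have hp0 : p ≠ 0 := (zero_lt_one.trans_le hp).ne'
    have hr1 : 1 ≤ p.toReal := by simpa using ENNReal.toReal_mono hpt hp
    have hr0 : 0 < p.toReal := by linarith
    rw [eLpNorm_eq_lintegral_rpow_enorm_toReal hp0 hpt,
      eLpNorm_eq_lintegral_rpow_enorm_toReal hp0 hpt]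
    simp only [enorm_eq_self]
    set r := p.toReal
    have hri : 0 ≤ 1 - 1 / r := by
      rw [sub_nonneg, div_le_one hr0]; exact hr1
    have hpt : ∀ z, (∫⁻ w, A w * B (z - w) ∂ν) ^ r ≤
        (∫⁻ w, A w ^ r * B (z - w) ∂ν) * (∫⁻ w, B w ∂ν) ^ (r - 1) := fun z => by
      -- Hölder for the splitting `A·B = (A^r B)^{1/r} · B^{1-1/r}`; when `r = 1` the second
      -- exponent is `0`.
      have h1 := ENNReal.lintegral_mul_norm_pow_le (μ := ν) (f := fun w => A w ^ r * B (z - w))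
        (g := fun w => B (z - w)) ((hA.pow_const r).mul (hBz z)).aemeasurable
        (hBz z).aemeasurable (p := 1 / r) (q := 1 - 1 / r) (by positivity) hri (by ring)
      have h2 : ∀ w, (A w ^ r * B (z - w)) ^ (1 / r) * B (z - w) ^ (1 - 1 / r) =
          A w * B (z - w) := fun w => by
        rw [ENNReal.mul_rpow_of_nonneg _ _ (by positivity), ← ENNReal.rpow_mul,
          mul_one_div_cancel hr0.ne', ENNReal.rpow_one, mul_assoc,
          ← ENNReal.rpow_add_of_nonneg _ _ (by positivity) hri]
        simp
      simp only [h2] at h1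
      rw [lintegral_sub_left_eq_self B z] at h1
      refine (ENNReal.rpow_le_rpow h1 hr0.le).trans (le_of_eq ?_)
      rw [ENNReal.mul_rpow_of_nonneg _ _ hr0.le, ← ENNReal.rpow_mul, ← ENNReal.rpow_mul,
        one_div_mul_cancel hr0.ne', ENNReal.rpow_one, sub_mul, one_div_mul_cancel hr0.ne', one_mul]
    have hm : AEMeasurable (Function.uncurry fun z w => A w ^ r * B (z - w)) (ν.prod ν) :=
      (((hA.pow_const r).comp measurable_snd).mul
        (hB.comp (measurable_fst.sub measurable_snd))).aemeasurable
    have hright : ∀ w, ∫⁻ z, B (z - w) ∂ν = ∫⁻ z, B z ∂ν := fun w =>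
      lintegral_sub_right_eq_self B w
    have hI : ∫⁻ z, (∫⁻ w, A w * B (z - w) ∂ν) ^ r ∂ν ≤
        (∫⁻ w, A w ^ r ∂ν) * (∫⁻ w, B w ∂ν) ^ r := by
      have hmz : Measurable fun z => ∫⁻ w, A w ^ r * B (z - w) ∂ν :=
        Measurable.lintegral_prod_right' (f := fun q : G × G => A q.2 ^ r * B (q.1 - q.2))
          (((hA.pow_const r).comp measurable_snd).mul
            (hB.comp (measurable_fst.sub measurable_snd)))
      refine (lintegral_mono hpt).trans (le_of_eq ?_)
      rw [lintegral_mul_const _ hmz, lintegral_lintegral_swap hm]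
      have h3 : ∀ w, ∫⁻ z, A w ^ r * B (z - w) ∂ν = A w ^ r * ∫⁻ z, B z ∂ν := fun w => by
        have hBw : Measurable fun z => B (z - w) := hB.comp (measurable_id.sub_const w)
        rw [lintegral_const_mul _ hBw, hright]
      simp only [h3]
      rw [lintegral_mul_const _ (hA.pow_const r), mul_assoc]
      congr 1
      conv_lhs => enter [1]; rw [← ENNReal.rpow_one (∫⁻ z, B z ∂ν)]
      rw [← ENNReal.rpow_add_of_nonneg _ _ zero_le_one (by linarith), add_sub_cancel]
    refine (ENNReal.rpow_le_rpow hI (by positivity)).trans (le_of_eq ?_)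
    rw [ENNReal.mul_rpow_of_nonneg _ _ (by positivity), ← ENNReal.rpow_mul,
      mul_one_div_cancel hr0.ne', ENNReal.rpow_one]

end Convolution

/-! ### The Rihaczek form bounded by the short-time Fourier transform. -/

section STFT

variable {ω : ℝ → ℝ} {K τ : ℝ} {f g : RN N → ℂ}

/-- The short-time Fourier transform of `f` with window `g`. -/
def stft (g f : RN N → ℂ) (z : Phase N) : ℂ :=
  fourierT (fun t => f t * (starRingEnd ℂ) (g (t - z.1))) z.2

/-- Inversion plus the triangle inequality. If the transform is not integrable the right side is
`∞`, so no such hypothesis has to be checked for windowed functions. -/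
theorem enorm_le_lintegral_fourierT {φ : RN N → ℂ} (hφ : Integrable φ) (hc : Continuous φ)
    (y : RN N) : ENNReal.ofReal ((2 * Real.pi) ^ N) * ‖φ y‖ₑ ≤ ∫⁻ ξ, ‖fourierT φ ξ‖ₑ := by
  by_cases h : Integrable (fourierT φ)
  · have h4 : ENNReal.ofReal ((2 * Real.pi) ^ N) = ‖((2 : ℂ) * Real.pi) ^ N‖ₑ := by
      rw [← ofReal_norm]; simp [abs_of_pos Real.pi_pos]
    rw [h4, ← enorm_mul, ← fourierT_inversion hφ hc h y]
    refine (enorm_integral_le_lintegral_enorm _).trans (le_of_eq ?_)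
    congr 1
    ext ξ
    rw [enorm_mul, ← conj_char, RCLike.enorm_conj, enorm_char, one_mul]
  · have : ∫⁻ ξ, ‖fourierT φ ξ‖ₑ = ∞ := by
      by_contra hne
      exact h ⟨(continuous_fourierT hφ).aestronglyMeasurable, lt_top_iff_ne_top.2 hne⟩
    rw [this]
    exact le_top

theorem RapidDecay.exists_bound (hg : RapidDecay ω g) : ∃ C : ℝ, ∀ x, ‖g x‖ ≤ C := by
  obtain ⟨C, hC⟩ := hg.decay 0 le_rfl
  exact ⟨C, fun x => by simpa using hC x⟩

theorem RapidDecay.exists_bound_fourier (hg : RapidDecay ω g) :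
    ∃ C : ℝ, ∀ x, ‖fourierT g x‖ ≤ C := by
  obtain ⟨C, hC⟩ := hg.decay_fourier 0 le_rfl
  exact ⟨C, fun x => by simpa using hC x⟩

theorem integrable_mul_conj {f g : RN N → ℂ} (hf : Integrable f) (hgc : Continuous g)
    (hb : ∃ C : ℝ, ∀ x, ‖g x‖ ≤ C) {T : RN N → RN N} (hT : Continuous T) :
    Integrable fun t => f t * (starRingEnd ℂ) (g (T t)) := by
  obtain ⟨C, hC⟩ := hb
  have h := hf.bdd_mul (c := C) (f := fun t => (starRingEnd ℂ) (g (T t)))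
    (Complex.continuous_conj.comp (hgc.comp hT)).aestronglyMeasurable
    (Filter.Eventually.of_forall fun t => by rw [RCLike.norm_conj]; exact hC _)
  simpa only [mul_comm] using h

theorem continuous_stft (hf : Integrable f) (hfc : Continuous f) (hgc : Continuous g)
    (hb : ∃ C : ℝ, ∀ x, ‖g x‖ ≤ C) : Continuous (stft g f) := by
  obtain ⟨C, hC⟩ := hb
  unfold stft fourierT
  refine continuous_of_dominated (bound := fun t => C * ‖f t‖) (fun z => ?_) (fun z => ?_)
    (hf.norm.const_mul C) ?_
  · exact Continuous.aestronglyMeasurable (by fun_prop)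
  · refine Filter.Eventually.of_forall fun t => ?_
    rw [norm_mul, norm_char, one_mul, norm_mul, RCLike.norm_conj, mul_comm]
    exact mul_le_mul_of_nonneg_right (hC _) (norm_nonneg _)
  · exact Filter.Eventually.of_forall fun t => by fun_prop

/-- A weighted pointwise bound by the short-time Fourier transform. -/
theorem weighted_enorm_le_stft (hω : IsWeightFunction ω) (hK : CondAlpha ω K)
    (hf : Integrable f) (hfc : Continuous f) (hgc : Continuous g)
    (hb : ∃ C : ℝ, ∀ x, ‖g x‖ ≤ C) {s : ℝ} (hs : 0 ≤ s) {M : ℝ≥0∞}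
    (hM : ∀ x, expW ω (K * s) ‖x‖ * ‖g x‖ₑ ≤ M) (y : RN N) :
    ENNReal.ofReal ((2 * Real.pi) ^ N) * (∫⁻ x, ‖g x‖ₑ ^ 2) * (expW ω s ‖y‖ * ‖f y‖ₑ) ≤
      ENNReal.ofReal (Real.exp (K * s)) * M *
        ∫⁻ x, ∫⁻ ξ, expW ω (K * s) ‖x‖ * ‖stft g f (x, ξ)‖ₑ := by
  -- Inversion at `y` of `f` times the window centred at `x`. Multiplying by `|g(y-x)|` and
  -- integrating over `x` produces `‖g‖₂²` on the left.
  have h1 : ∀ x, ENNReal.ofReal ((2 * Real.pi) ^ N) * (‖f y‖ₑ * ‖g (y - x)‖ₑ) ≤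
      ∫⁻ ξ, ‖stft g f (x, ξ)‖ₑ := fun x => by
    have h := enorm_le_lintegral_fourierT
      (integrable_mul_conj hf hgc hb (T := fun t => t - x) (by fun_prop))
      (by fun_prop) y
    rwa [enorm_mul, RCLike.enorm_conj] at h
  have h2 : ∀ x, expW ω s ‖y‖ ≤ ENNReal.ofReal (Real.exp (K * s)) *
      (expW ω (K * s) ‖x‖ * expW ω (K * s) ‖y - x‖) := fun x => by
    simp only [expW, ofReal_exp_mul]
    refine ofReal_exp_mono ?_
    have := mul_le_mul_of_nonneg_left (hω.norm_sub_le hK x y) hs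
    linarith
  have hV := (continuous_stft hf hfc hgc hb).enorm.measurable
  rw [← lintegral_sub_left_eq_self (μ := volume) (fun x => ‖g x‖ₑ ^ 2) y]
  have hm : Measurable fun x => ‖g (y - x)‖ₑ ^ 2 :=
    (Continuous.measurable (f := fun x => ‖g (y - x)‖ₑ) (by fun_prop)).pow_const 2
  rw [← lintegral_const_mul _ hm, ← lintegral_mul_const _ (hm.const_mul _)]
  have hm2 : Measurable fun x => ∫⁻ ξ, expW ω (K * s) ‖x‖ * ‖stft g f (x, ξ)‖ₑ :=
    Measurable.lintegral_prod_right' (f := fun z : Phase N => expW ω (K * s) ‖z.1‖ * ‖stft g f z‖ₑ)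
      (((hω.measurable_expW_norm (K * s)).comp measurable_fst).mul hV)
  rw [← lintegral_const_mul _ hm2]
  refine lintegral_mono fun x => ?_
  rw [lintegral_const_mul' _ _ (expW_ne_top _ _ _)]
  calc ENNReal.ofReal ((2 * Real.pi) ^ N) * ‖g (y - x)‖ₑ ^ 2 * (expW ω s ‖y‖ * ‖f y‖ₑ)
      = expW ω s ‖y‖ * ‖g (y - x)‖ₑ *
        (ENNReal.ofReal ((2 * Real.pi) ^ N) * (‖f y‖ₑ * ‖g (y - x)‖ₑ)) := by ring
    _ ≤ ENNReal.ofReal (Real.exp (K * s)) * (expW ω (K * s) ‖x‖ * expW ω (K * s) ‖y - x‖) *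
        ‖g (y - x)‖ₑ * ∫⁻ ξ, ‖stft g f (x, ξ)‖ₑ :=
        mul_le_mul' (mul_le_mul_left (h2 x) _) (h1 x)
    _ = ENNReal.ofReal (Real.exp (K * s)) * (expW ω (K * s) ‖y - x‖ * ‖g (y - x)‖ₑ) *
        (expW ω (K * s) ‖x‖ * ∫⁻ ξ, ‖stft g f (x, ξ)‖ₑ) := by ring
    _ ≤ _ := by gcongr; exact hM _

/-- The fundamental identity of time-frequency analysis, for absolute values. -/
theorem enorm_stft_fourier (hf : RapidDecay ω f) (hg : RapidDecay ω g) (x ξ : RN N) :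
    ‖stft (fourierT g) (fourierT f) (ξ, -x)‖ₑ =
      ENNReal.ofReal ((2 * Real.pi) ^ N) * ‖stft g f (x, ξ)‖ₑ := by
  have hG : ∀ w, fourierT (fun t => g (t - x)) w =
      Complex.exp (-(Complex.I * ((inner ℝ x w : ℝ) : ℂ))) * fourierT g w := fun w => by
    rw [fourierT, fourierT, ← integral_const_mul, ← integral_add_right_eq_self _ x]
    congr 1
    ext t
    rw [add_sub_cancel_right, ← mul_assoc, ← Complex.exp_add, inner_add_left]
    congr 2
    push_cast
    ring
  have hGi : Integrable (fourierT fun t => g (t - x)) := by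
    rw [show (fourierT fun t => g (t - x)) = _ from funext hG]
    refine hg.integrable_fourier.bdd_mul (c := 1) (Continuous.aestronglyMeasurable (by fun_prop))
      (Filter.Eventually.of_forall fun t => (norm_char x t).le)
  have h := parseval_modulated hf.integrable (hg.integrable.comp_sub_right x)
    (hg.continuous.comp (by fun_prop)) hGi ξ
  have h1 : ∫ t, Complex.exp (-(Complex.I * ((inner ℝ t ξ : ℝ) : ℂ))) * f t *
        (starRingEnd ℂ) (g (t - x)) = stft g f (x, ξ) := by
    rw [stft, fourierT]
    simp only [mul_assoc]
  have h2 : ∫ v, fourierT f v * (starRingEnd ℂ) (fourierT (fun t => g (t - x)) (v - ξ)) =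
      Complex.exp (-(Complex.I * ((inner ℝ x ξ : ℝ) : ℂ))) *
        stft (fourierT g) (fourierT f) (ξ, -x) := by
    rw [stft]
    conv_rhs => rw [fourierT, ← integral_const_mul]
    congr 1
    ext v
    rw [hG, map_mul, conj_char]
    have : Complex.exp (Complex.I * ((inner ℝ x (v - ξ) : ℝ) : ℂ)) =
        Complex.exp (-(Complex.I * ((inner ℝ x ξ : ℝ) : ℂ))) *
          Complex.exp (-(Complex.I * ((inner ℝ v (-x) : ℝ) : ℂ))) := by
      rw [← Complex.exp_add, inner_sub_right, inner_neg_right, real_inner_comm v x]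
      congr 1
      push_cast
      ring
    rw [this]
    ring
  rw [h1, h2] at h
  have h3 := congrArg enorm h
  rw [enorm_mul, enorm_mul, enorm_char, one_mul] at h3
  rw [h3]
  congr 1
  rw [← ofReal_norm]; simp [abs_of_pos Real.pi_pos]

/-- The weighted Rihaczek form is bounded by the weighted `L¹` norm of the short-time Fourier
transform. -/
theorem RapidDecay.rihaczek_le_stft (hf : RapidDecay ω f) (hg : RapidDecay ω g)
    (hω : IsWeightFunction ω) (hK : CondAlpha ω K) {lam : ℝ} (hl : 0 ≤ lam) {M M' : ℝ≥0∞}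
    (hM : ∀ x, expW ω (K ^ 2 * lam) ‖x‖ * ‖g x‖ₑ ≤ M)
    (hM' : ∀ x, expW ω (K ^ 2 * lam) ‖x‖ * ‖fourierT g x‖ₑ ≤ M') (z : Phase N) :
    ENNReal.ofReal ((2 * Real.pi) ^ (2 * N)) * (∫⁻ x, ‖g x‖ₑ ^ 2) ^ 2 *
        (expW ω lam (phaseNorm z) * ‖rihaczek f z‖ₑ) ≤
      ENNReal.ofReal (Real.exp (K * (1 + 2 * K) * lam)) * M * M' *
        (∫⁻ w : Phase N, expW ω (K ^ 2 * lam) (phaseNorm w) * ‖stft g f w‖ₑ) ^ 2 := by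
  have hK0 : 0 ≤ K := zero_le_one.trans hK.1
  have hs : 0 ≤ K * lam := by positivity
  have hKK : K * (K * lam) = K ^ 2 * lam := by ring
  have h1 := weighted_enorm_le_stft hω hK hf.integrable hf.continuous hg.continuous hg.exists_bound
    hs (M := M) (by rwa [hKK]) z.1
  have h2 := weighted_enorm_le_stft hω hK hf.integrable_fourier hf.continuous_fourier
    hg.continuous_fourier hg.exists_bound_fourier hs (M := M') (by rwa [hKK]) z.2
  rw [hKK] at h1 h2
  rw [hg.plancherel] at h2
  have hV := (continuous_stft hf.integrable hf.continuous hg.continuous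
    hg.exists_bound).enorm.measurable
  set P := ENNReal.ofReal ((2 * Real.pi) ^ N) with hP
  have hP0 : P ≠ 0 := (ENNReal.ofReal_pos.2 (by positivity)).ne'
  set G := ∫⁻ x, ‖g x‖ₑ ^ 2
  set I := ∫⁻ w : Phase N, expW ω (K ^ 2 * lam) (phaseNorm w) * ‖stft g f w‖ₑ with hI
  have hmono : ∀ {r R : ℝ}, ω r ≤ ω R → expW ω (K ^ 2 * lam) r ≤ expW ω (K ^ 2 * lam) R :=
    fun h => ofReal_exp_mono (mul_le_mul_of_nonneg_left h (by positivity))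
  have hIm : AEMeasurable (fun w : Phase N => expW ω (K ^ 2 * lam) (phaseNorm w) * ‖stft g f w‖ₑ)
      (volume.prod volume) := ((hω.measurable_expW_phase _).mul hV).aemeasurable
  have h3 : ∫⁻ x, ∫⁻ ξ, expW ω (K ^ 2 * lam) ‖x‖ * ‖stft g f (x, ξ)‖ₑ ≤ I := by
    rw [hI, Measure.volume_eq_prod, lintegral_prod _ hIm]
    refine lintegral_mono fun x => lintegral_mono fun ξ => ?_
    gcongr
    exact hmono (hω.fst_le (x, ξ))
  -- The rotation exchanges the variables and reflects one of them; it costs a factor `(2π)^N`,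
  -- cancelled below against the one that Plancherel gives for `‖ĝ‖₂²`.
  have h4 : ∫⁻ ξ, ∫⁻ y, expW ω (K ^ 2 * lam) ‖ξ‖ * ‖stft (fourierT g) (fourierT f) (ξ, y)‖ₑ ≤
      P * I := by
    rw [hI, Measure.volume_eq_prod, lintegral_prod_symm _ hIm,
      ← lintegral_const_mul' _ _ ENNReal.ofReal_ne_top]
    refine lintegral_mono fun ξ => ?_
    rw [← lintegral_const_mul' _ _ ENNReal.ofReal_ne_top, ← lintegral_neg_eq_self]
    refine lintegral_mono fun x => ?_
    rw [enorm_stft_fourier hf hg, mul_left_comm]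
    gcongr
    exact hmono (hω.snd_le (x, ξ))
  have h5 : P * (P * G * (expW ω (K * lam) ‖z.2‖ * ‖fourierT f z.2‖ₑ)) ≤
      P * (ENNReal.ofReal (Real.exp (K ^ 2 * lam)) * M' * I) := by
    calc _ = P * (P * G) * (expW ω (K * lam) ‖z.2‖ * ‖fourierT f z.2‖ₑ) := by ring
      _ ≤ _ := h2
      _ ≤ ENNReal.ofReal (Real.exp (K ^ 2 * lam)) * M' * (P * I) := by gcongr
      _ = _ := by ring
  have h6 := (ENNReal.mul_le_mul_iff_right hP0 ENNReal.ofReal_ne_top).1 h5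
  have h7 : P * G * (expW ω (K * lam) ‖z.1‖ * ‖f z.1‖ₑ) ≤
      ENNReal.ofReal (Real.exp (K ^ 2 * lam)) * M * I := h1.trans (by gcongr)
  have hPP : ENNReal.ofReal ((2 * Real.pi) ^ (2 * N)) = P * P := by
    rw [hP, ← ENNReal.ofReal_mul (by positivity)]; congr 1; ring
  calc _ ≤ P * P * G ^ 2 * (ENNReal.ofReal (Real.exp (K * lam)) *
        (expW ω (K * lam) ‖z.1‖ * expW ω (K * lam) ‖z.2‖) * (‖f z.1‖ₑ * ‖fourierT f z.2‖ₑ)) := by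
        rw [hPP, enorm_rihaczek]
        gcongr
        exact expW_phase_le hω hK hl z
    _ = ENNReal.ofReal (Real.exp (K * lam)) * ((P * G * (expW ω (K * lam) ‖z.1‖ * ‖f z.1‖ₑ)) *
        (P * G * (expW ω (K * lam) ‖z.2‖ * ‖fourierT f z.2‖ₑ))) := by ring
    _ ≤ ENNReal.ofReal (Real.exp (K * lam)) * ((ENNReal.ofReal (Real.exp (K ^ 2 * lam)) * M * I) *
        (ENNReal.ofReal (Real.exp (K ^ 2 * lam)) * M' * I)) := by gcongr
    _ = (ENNReal.ofReal (Real.exp (K * lam)) * (ENNReal.ofReal (Real.exp (K ^ 2 * lam)) *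
        ENNReal.ofReal (Real.exp (K ^ 2 * lam)))) * M * M' * I ^ 2 := by ring
    _ = _ := by
        rw [ofReal_exp_mul, ofReal_exp_mul]
        congr 5
        ring

end STFT

end TimeFreq
end

noncomputable section

namespace TimeFreq

variable {N : ℕ}

/-! ### The squared short-time Fourier transform as a convolution of Wigner transforms. -/

section Moyal

variable {ω : ℝ → ℝ} {K τ : ℝ} {f g : RN N → ℂ}

/-- The squared modulus of an integral, as an integral over midpoints weighted by `τ`. -/
theorem enorm_integral_sq_le {φ : RN N → ℂ} (hφ : Integrable φ) (τ : ℝ) :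
    ‖∫ t, φ t‖ₑ ^ 2 ≤
      ∫⁻ u, ‖∫ t, φ (u + τ • t) * (starRingEnd ℂ) (φ (u - (1 - τ) • t))‖ₑ := by
  have hφc : Integrable fun s => (starRingEnd ℂ) (φ s) :=
    Complex.conjLIE.toContinuousLinearEquiv.integrable_comp_iff.2 hφ
  have hH : Integrable (fun q : RN N × RN N => φ q.2 * (starRingEnd ℂ) (φ (q.2 - q.1)))
      (volume.prod volume) := by
    have h := hφ.convolution_integrand (ContinuousLinearMap.mul ℝ ℂ) hφc.comp_neg (μ := volume)
    refine h.congr (Filter.Eventually.of_forall fun q => ?_)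
    simp
  -- The shear `a = u + τt` turns the pair `(a, a - t)` into `(u + τt, u - (1-τ)t)`.
  have hmp : MeasurePreserving (fun q : RN N × RN N => (q.1, q.2 + τ • q.1))
      (volume.prod volume) (volume.prod volume) :=
    MeasurePreserving.skew_product (MeasurePreserving.id volume)
      (g := fun t u => u + τ • t) (by fun_prop)
      (Filter.Eventually.of_forall fun t => map_add_right_eq_self volume (τ • t))
  have hH2 : Integrable (Function.uncurry fun t u : RN N =>
      φ (u + τ • t) * (starRingEnd ℂ) (φ (u - (1 - τ) • t))) (volume.prod volume) := by
    refine (hmp.integrable_comp_of_integrable hH).congr (Filter.Eventually.of_forall fun q => ?_)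
    simp only [Function.comp_apply, Function.uncurry]
    congr 3
    module
  have key : (∫ t, φ t) * (starRingEnd ℂ) (∫ t, φ t) =
      ∫ u, ∫ t, φ (u + τ • t) * (starRingEnd ℂ) (φ (u - (1 - τ) • t)) := by
    calc (∫ t, φ t) * (starRingEnd ℂ) (∫ t, φ t)
        = ∫ a, ∫ t, φ a * (starRingEnd ℂ) (φ (a - t)) := by
          rw [← integral_conj, ← integral_mul_const]
          congr 1; ext a
          rw [integral_const_mul, integral_sub_left_eq_self (fun t => (starRingEnd ℂ) (φ t))]
      _ = ∫ t, ∫ a, φ a * (starRingEnd ℂ) (φ (a - t)) :=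
          (integral_integral_swap (f := fun t a => φ a * (starRingEnd ℂ) (φ (a - t))) hH).symm
      _ = ∫ t, ∫ u, φ (u + τ • t) * (starRingEnd ℂ) (φ (u - (1 - τ) • t)) := by
          congr 1; ext t
          rw [← integral_add_right_eq_self _ (τ • t)]
          congr 1; ext u
          congr 3
          module
      _ = _ := integral_integral_swap hH2
  have h2 := congrArg enorm key
  rw [enorm_mul, RCLike.enorm_conj, ← pow_two] at h2
  rw [h2]
  exact enorm_integral_le_lintegral_enorm _

theorem wig_eq_fourierT (τ : ℝ) (f : RN N → ℂ) (x ξ : RN N) : wig τ f (x, ξ) =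
    fourierT (fun t => f (x + τ • t) * (starRingEnd ℂ) (f (x - (1 - τ) • t))) ξ := by
  rw [wig, fourierT]; simp only [mul_assoc]

theorem RapidDecay.integrable_wig_kernel (hf : RapidDecay ω f) (hτ : τ ∈ Set.Ioo (0 : ℝ) 1)
    (x : RN N) :
    Integrable fun t => f (x + τ • t) * (starRingEnd ℂ) (f (x - (1 - τ) • t)) :=
  integrable_mul_conj (hf.integrable_affine x hτ.1.ne') hf.continuous hf.exists_bound (by fun_prop)

theorem RapidDecay.integrable_wig_snd (hf : RapidDecay ω f) (hω : IsWeightFunction ω)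
    (hτ : τ ∈ Set.Ioo (0 : ℝ) 1) (x : RN N) : Integrable fun ξ => wig τ f (x, ξ) := by
  obtain ⟨r, hr, hi, -⟩ := weight_exponent_exists hω N
  obtain ⟨C, hC⟩ := hf.wig_decay hω hτ r hr
  have hc : Continuous fun ξ => wig τ f (x, ξ) := by
    simp only [wig_eq_fourierT]
    exact continuous_fourierT (hf.integrable_wig_kernel hτ x)
  refine (hi.const_mul C).mono' hc.aestronglyMeasurable (Filter.Eventually.of_forall fun ξ => ?_)
  rw [neg_mul, Real.exp_neg, ← div_eq_mul_inv, le_div_iff₀ (Real.exp_pos _), mul_comm]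
  refine le_trans ?_ (hC (x, ξ))
  gcongr
  exact hω.snd_le (x, ξ)

/-- The preceding inequality is applied to `φ(t) = e^{-itξ} f(t) conj(g(t-x))`. The phases in
`φ(u+τt) conj φ(u-(1-τ)t)` combine to `e^{-itξ}`, leaving the Wigner kernels of `f` at `u` and of
`g` at `u - x`; Parseval in `t` then yields the two transforms. -/
theorem stft_sq_le_wig (hf : RapidDecay ω f) (hg : RapidDecay ω g) (hω : IsWeightFunction ω)
    (hτ : τ ∈ Set.Ioo (0 : ℝ) 1) (x ξ : RN N) :
    ENNReal.ofReal ((2 * Real.pi) ^ N) * ‖stft g f (x, ξ)‖ₑ ^ 2 ≤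
      ∫⁻ u, ∫⁻ v, ‖wig τ f (u, v)‖ₑ * ‖wig τ g (u - x, v - ξ)‖ₑ := by
  have hφ : Integrable fun t => Complex.exp (-(Complex.I * ((inner ℝ t ξ : ℝ) : ℂ))) *
      (f t * (starRingEnd ℂ) (g (t - x))) :=
    integrable_char_mul (integrable_mul_conj hf.integrable hg.continuous hg.exists_bound
      (by fun_prop)) ξ
  have h1 := mul_le_mul_right (enorm_integral_sq_le hφ τ) (ENNReal.ofReal ((2 * Real.pi) ^ N))
  refine h1.trans ?_
  rw [← lintegral_const_mul' _ _ ENNReal.ofReal_ne_top]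
  refine lintegral_mono fun u => ?_
  set F : RN N → ℂ := fun t => f (u + τ • t) * (starRingEnd ℂ) (f (u - (1 - τ) • t)) with hF
  set G : RN N → ℂ := fun t => g (u - x + τ • t) * (starRingEnd ℂ) (g (u - x - (1 - τ) • t)) with hG
  have hGF : fourierT G = fun v => wig τ g (u - x, v) :=
    funext fun v => (wig_eq_fourierT _ _ _ _).symm
  have hgc := hg.continuous
  have h2 := parseval_modulated (hf.integrable_wig_kernel hτ u) (hg.integrable_wig_kernel hτ (u - x))
    (by fun_prop) (hGF ▸ hg.integrable_wig_snd hω hτ (u - x)) ξ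
  have h3 : ∀ t, Complex.exp (-(Complex.I * ((inner ℝ (u + τ • t) ξ : ℝ) : ℂ))) *
        (f (u + τ • t) * (starRingEnd ℂ) (g (u + τ • t - x))) *
        (starRingEnd ℂ) (Complex.exp (-(Complex.I * ((inner ℝ (u - (1 - τ) • t) ξ : ℝ) : ℂ))) *
        (f (u - (1 - τ) • t) * (starRingEnd ℂ) (g (u - (1 - τ) • t - x)))) =
      Complex.exp (-(Complex.I * ((inner ℝ t ξ : ℝ) : ℂ))) * F t * (starRingEnd ℂ) (G t) :=
    fun t => by
    have h4 : Complex.exp (-(Complex.I * ((inner ℝ t ξ : ℝ) : ℂ))) =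
        Complex.exp (-(Complex.I * ((inner ℝ (u + τ • t) ξ : ℝ) : ℂ))) *
        Complex.exp (Complex.I * ((inner ℝ (u - (1 - τ) • t) ξ : ℝ) : ℂ)) := by
      rw [← Complex.exp_add, inner_sub_left, inner_add_left, real_inner_smul_left,
        real_inner_smul_left]
      congr 1
      push_cast
      ring
    rw [map_mul, conj_char, h4, hF, hG]
    simp only [map_mul, Complex.conj_conj]
    rw [show u - x + τ • t = u + τ • t - x by abel,
      show u - x - (1 - τ) • t = u - (1 - τ) • t - x by abel]
    ring
  simp only [h3]
  have h5 : ENNReal.ofReal ((2 * Real.pi) ^ N) = ‖((2 : ℂ) * Real.pi) ^ N‖ₑ := by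
    rw [← ofReal_norm]; simp [abs_of_pos Real.pi_pos]
  rw [h5, ← enorm_mul, ← h2]
  refine (enorm_integral_le_lintegral_enorm _).trans (le_of_eq ?_)
  congr 1
  ext v
  rw [enorm_mul, RCLike.enorm_conj, wig_eq_fourierT, wig_eq_fourierT]

/-- Turns the correlation `Wig_τ g(w - z)` into the convolution factor `Wig_{1-τ}(g̃)(z - w)`, up to
conjugation. -/
theorem wig_reflect (τ : ℝ) (g : RN N → ℂ) (z : Phase N) :
    wig (1 - τ) (reflect g) z = (starRingEnd ℂ) (wig τ g (-z)) := by
  rw [wig, wig, ← integral_conj]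
  congr 1
  ext t
  simp only [map_mul, Complex.conj_conj, reflect, Prod.fst_neg, Prod.snd_neg,
    inner_neg_right, Complex.ofReal_neg, mul_neg, sub_sub_cancel]
  rw [show -(z.1 + (1 - τ) • t) = -z.1 - (1 - τ) • t by abel,
    show -(z.1 - τ • t) = -z.1 + τ • t by abel, neg_neg, ← conj_char, Complex.conj_conj]
  ring

theorem measurable_wig (hf : Continuous f) (τ : ℝ) : Measurable (wig τ f) := by
  refine StronglyMeasurable.measurable (StronglyMeasurable.integral_prod_right
    (f := fun (z : Phase N) (t : RN N) => Complex.exp (-(Complex.I * ((inner ℝ t z.2 : ℝ) : ℂ))) *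
    f (z.1 + τ • t) * (starRingEnd ℂ) (f (z.1 - (1 - τ) • t))) (Continuous.stronglyMeasurable ?_))
  unfold Function.uncurry
  fun_prop

/-- The weighted `L^{2p}` norm of the short-time Fourier transform is controlled by the weighted
norms of the Wigner transforms. -/
theorem RapidDecay.stft_norm_sq_le (hf : RapidDecay ω f) (hg : RapidDecay ω g)
    (hω : IsWeightFunction ω) (hK : CondAlpha ω K) (hτ : τ ∈ Set.Ioo (0 : ℝ) 1) {c : ℝ}
    (hc : 0 ≤ c) {p : ℝ≥0∞} (hp : 1 ≤ p) :
    wNormPhase ω c (stft g f) (2 * p) ^ 2 ≤ ENNReal.ofReal (Real.exp (2 * K * c)) *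
      wNormPhase ω (2 * K * c) (wig (1 - τ) (TimeFreq.reflect g)) 1 *
      wNormPhase ω (2 * K * c) (wig τ f) p := by
  have hinst : (volume : Measure (Phase N)).IsAddHaarMeasure :=
    inferInstanceAs ((volume : Measure (RN N)).prod (volume : Measure (RN N))).IsAddHaarMeasure
  have hneg : (volume : Measure (Phase N)).IsNegInvariant :=
    ⟨((Measure.measurePreserving_neg (volume : Measure (RN N))).prod
      (Measure.measurePreserving_neg (volume : Measure (RN N)))).map_eq⟩
  have hgr : Continuous (TimeFreq.reflect g) := hg.reflect.continuous
  set A : Phase N → ℝ≥0∞ := fun w => expW ω (2 * K * c) (phaseNorm w) * ‖wig τ f w‖ₑ with hA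
  set B : Phase N → ℝ≥0∞ := fun w => ENNReal.ofReal (Real.exp (2 * K * c)) *
    (expW ω (2 * K * c) (phaseNorm w) * ‖wig (1 - τ) (TimeFreq.reflect g) w‖ₑ) with hB
  have hwf := (measurable_wig hf.continuous τ).enorm
  have hwg := (measurable_wig hgr (1 - τ)).enorm
  have hAm : Measurable A := (hω.measurable_expW_phase _).mul hwf
  have hBm : Measurable B := ((hω.measurable_expW_phase _).mul hwg).const_mul _
  have hpt : ∀ z : Phase N, ‖((Real.exp (c * ω (phaseNorm z)) : ℝ) : ℂ) * stft g f z‖ₑ ^ 2 ≤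
      ∫⁻ w, A w * B (z - w) := fun z => by
    have h1 : ‖stft g f z‖ₑ ^ 2 ≤
        ∫⁻ w : Phase N, ‖wig τ f w‖ₑ * ‖wig (1 - τ) (TimeFreq.reflect g) (z - w)‖ₑ := by
      have h2 := stft_sq_le_wig hf hg hω hτ z.1 z.2
      -- The factor `(2π)^N ≥ 1` is simply discarded.
      have h3 : (1 : ℝ≥0∞) ≤ ENNReal.ofReal ((2 * Real.pi) ^ N) := by
        rw [← ENNReal.ofReal_one]
        refine ENNReal.ofReal_le_ofReal (one_le_pow₀ ?_)
        linarith [Real.pi_gt_three]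
      have h4 : AEMeasurable (fun w : Phase N =>
          ‖wig τ f w‖ₑ * ‖wig (1 - τ) (TimeFreq.reflect g) (z - w)‖ₑ)
          (volume.prod volume) :=
        (hwf.mul (hwg.comp (measurable_id.const_sub z))).aemeasurable
      rw [Measure.volume_eq_prod, lintegral_prod _ h4]
      refine le_trans ((one_mul _).symm.le.trans (mul_le_mul_left h3 _)) (h2.trans (le_of_eq ?_))
      congr 1; ext u; congr 1; ext v
      rw [wig_reflect, RCLike.enorm_conj, neg_sub]
      rfl
    rw [enorm_exp_mul, mul_pow]
    refine (mul_le_mul_right h1 _).trans ?_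
    rw [← lintegral_const_mul' _ _ (ENNReal.pow_ne_top ENNReal.ofReal_ne_top)]
    refine lintegral_mono fun w => ?_
    -- Squaring doubles `c` and the split of `ω(z)` costs `K`: hence the exponent `2Kc`.
    have h5 : ENNReal.ofReal (Real.exp (c * ω (phaseNorm z))) ^ 2 ≤
        ENNReal.ofReal (Real.exp (2 * K * c)) * (expW ω (2 * K * c) (phaseNorm w) *
          expW ω (2 * K * c) (phaseNorm (z - w))) := by
      rw [pow_two]
      simp only [expW, ofReal_exp_mul]
      refine ofReal_exp_mono ?_
      have := mul_le_mul_of_nonneg_left (hω.phase_sub_le hK z w) hc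
      linarith
    refine (mul_le_mul_left h5 _).trans (le_of_eq ?_)
    simp only [hA, hB]
    ring
  have hY := eLpNorm_lintegral_conv_le (ν := (volume : Measure (Phase N))) hAm hBm hp
  have hL : wNormPhase ω c (stft g f) (2 * p) ^ 2 ≤
      eLpNorm (fun z : Phase N => ∫⁻ w, A w * B (z - w)) p volume := by
    -- `‖F‖_{2p}² = ‖|F|²‖_p`, which also covers `p = ∞`.
    have h6 := eLpNorm_enorm_rpow (p := p) (q := 2) (μ := volume)
      (fun z : Phase N => ((Real.exp (c * ω (phaseNorm z)) : ℝ) : ℂ) * stft g f z) two_pos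
    rw [ENNReal.ofReal_ofNat, mul_comm p, ENNReal.rpow_ofNat] at h6
    rw [wNormPhase, ← h6]
    refine eLpNorm_mono_enorm fun z => ?_
    simpa only [enorm_eq_self, ENNReal.rpow_ofNat] using hpt z
  refine hL.trans (hY.trans (le_of_eq ?_))
  have hAe : eLpNorm A p volume = wNormPhase ω (2 * K * c) (wig τ f) p := by
    rw [wNormPhase, ← eLpNorm_enorm (fun z : Phase N =>
      ((Real.exp (2 * K * c * ω (phaseNorm z)) : ℝ) : ℂ) * wig τ f z)]
    simp only [enorm_exp_mul]
    rfl
  have hBe : ∫⁻ w, B w = ENNReal.ofReal (Real.exp (2 * K * c)) *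
      wNormPhase ω (2 * K * c) (wig (1 - τ) (TimeFreq.reflect g)) 1 := by
    rw [wNormPhase, eLpNorm_one_eq_lintegral_enorm,
      lintegral_const_mul' _ _ ENNReal.ofReal_ne_top]
    simp only [enorm_exp_mul]
    rfl
  rw [hAe, hBe, mul_comm]

end Moyal

/-! ### Case (b): finiteness of the constants and the infimum over windows. -/

section Main

variable {ω : ℝ → ℝ} {K τ : ℝ} {f g : RN N → ℂ}

/-- A sublevel set of full measure is dense, and by continuity closed, so the essential bound holds
at every point. -/
theorem expW_mul_enorm_le_wNorm (hω : IsWeightFunction ω) {h : RN N → ℂ} (hc : Continuous h)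
    (s : ℝ) (x : RN N) : expW ω s ‖x‖ * ‖h x‖ₑ ≤ wNorm ω s h ∞ := by
  have hcont : Continuous fun x : RN N => ((Real.exp (s * ω ‖x‖) : ℝ) : ℂ) * h x :=
    (Complex.continuous_ofReal.comp
      (Real.continuous_exp.comp (continuous_const.mul hω.continuous_norm))).mul hc
  have h1 := enorm_ae_le_eLpNormEssSup (fun x : RN N => ((Real.exp (s * ω ‖x‖) : ℝ) : ℂ) * h x)
    volume
  have h2 := Measure.dense_of_ae h1
  have h3 : IsClosed {x : RN N | ‖((Real.exp (s * ω ‖x‖) : ℝ) : ℂ) * h x‖ₑ ≤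
      eLpNormEssSup (fun x : RN N => ((Real.exp (s * ω ‖x‖) : ℝ) : ℂ) * h x) volume} :=
    isClosed_le hcont.enorm continuous_const
  have h4 : x ∈ closure _ := h2 x
  rw [h3.closure_eq, Set.mem_ofPred_eq, enorm_exp_mul] at h4
  rw [wNorm, eLpNorm_exponent_top]
  exact h4

theorem wNorm_top_lt_top {h : RN N → ℂ} {s : ℝ}
    (hd : ∃ C : ℝ, ∀ x, Real.exp (s * ω ‖x‖) * ‖h x‖ ≤ C) : wNorm ω s h ∞ < ∞ := by
  obtain ⟨C, hC⟩ := hd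
  rw [wNorm, eLpNorm_exponent_top]
  refine eLpNormEssSup_lt_top_of_ae_bound (C := C) (Filter.Eventually.of_forall fun x => ?_)
  rw [norm_mul, Complex.norm_real, Real.norm_of_nonneg (Real.exp_pos _).le]
  exact hC x

theorem wNormPhase_neg_lt_top (hω : IsWeightFunction ω) {a b : ℝ} (hb : CondGamma ω a b)
    {q : ℝ≥0∞} (hq0 : q ≠ 0) (hqt : q ≠ ∞) {μ : ℝ} (hμ : 2 * (N : ℝ) / (b * q.toReal) < μ) :
    wNormPhase ω (-μ) (fun _ : Phase N => (1 : ℂ)) q < ∞ := by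
  have hb0 := hb.1
  have hq : 0 < q.toReal := ENNReal.toReal_pos hq0 hqt
  have hμ0 : 0 < μ := lt_of_le_of_lt (by positivity) hμ
  -- The threshold on `μ` is exactly integrability of `e^{-μqω}` on a space of dimension `2N`.
  have h1 : 2 * (N : ℝ) < μ * q.toReal * b := by
    rw [div_lt_iff₀ (by positivity)] at hμ
    linarith
  have h2 := (integrable_exp_neg_weight_phase hω hb (by positivity) h1).2
  rw [wNormPhase, eLpNorm_lt_top_iff_lintegral_rpow_enorm_lt_top hq0 hqt]
  refine lt_of_eq_of_lt ?_ h2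
  congr 1
  ext z
  rw [enorm_exp_mul, enorm_one, mul_one, ENNReal.ofReal_rpow_of_pos (Real.exp_pos _),
    ← Real.exp_mul, Real.enorm_of_nonneg (Real.exp_pos _).le]
  congr 2
  ring

theorem eLpNorm_two_pow_four (g : RN N → ℂ) :
    eLpNorm g 2 volume ^ 4 = (∫⁻ x, ‖g x‖ₑ ^ 2) ^ 2 := by
  rw [eLpNorm_eq_lintegral_rpow_enorm_toReal (by norm_num) (by norm_num)]
  simp only [ENNReal.toReal_ofNat, ENNReal.rpow_ofNat]
  rw [← ENNReal.rpow_natCast, ← ENNReal.rpow_mul, ← ENNReal.rpow_natCast]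
  congr 1
  norm_num

theorem RapidDecay.lintegral_sq_ne_zero (hg : RapidDecay ω g) (hω : IsWeightFunction ω)
    (hg0 : g ≠ 0) : ∫⁻ x, ‖g x‖ₑ ^ 2 ≠ 0 := by
  simpa [expW] using weighted_sq_ne_zero hω hg.continuous hg0 0

theorem RapidDecay.lintegral_sq_ne_top (hg : RapidDecay ω g) : ∫⁻ x, ‖g x‖ₑ ^ 2 ≠ ∞ := by
  rw [lintegral_enorm_sq_eq hg.integrable_sq]
  exact ENNReal.ofReal_ne_top

theorem RapidDecay.constD2_denom (hg : RapidDecay ω g) (hω : IsWeightFunction ω) (hg0 : g ≠ 0) :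
    ENNReal.ofReal ((2 * Real.pi) ^ (2 * N)) * eLpNorm g 2 volume ^ 4 ≠ 0 ∧
      ENNReal.ofReal ((2 * Real.pi) ^ (2 * N)) * eLpNorm g 2 volume ^ 4 ≠ ∞ := by
  rw [eLpNorm_two_pow_four]
  exact ⟨mul_ne_zero (ENNReal.ofReal_pos.2 (by positivity)).ne'
    (pow_ne_zero _ (hg.lintegral_sq_ne_zero hω hg0)),
    ENNReal.mul_ne_top ENNReal.ofReal_ne_top (ENNReal.pow_ne_top hg.lintegral_sq_ne_top)⟩

theorem one_le_two_mul {p : ℝ≥0∞} (hp : 1 ≤ p) : 1 < 2 * p :=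
  lt_of_lt_of_le (by norm_num : (1 : ℝ≥0∞) < 2 * 1) (by gcongr)

theorem conjExponent_two_mul_ne_top {p : ℝ≥0∞} (hp : 1 ≤ p) :
    ENNReal.conjExponent (2 * p) ≠ ∞ := by
  have := tsub_pos_of_lt (one_le_two_mul hp)
  simp [ENNReal.conjExponent, this.ne']

theorem conjExponent_ne_zero (p : ℝ≥0∞) : ENNReal.conjExponent p ≠ 0 := by
  simp [ENNReal.conjExponent]

/-- The sup-norm estimate for the weighted Rihaczek form in terms of the `τ`-Wigner transform. -/
theorem RapidDecay.rihaczek_le_wig (hf : RapidDecay ω f) (hg : RapidDecay ω g) (hg0 : g ≠ 0)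
    (hω : IsWeightFunction ω) (hK : CondAlpha ω K) (hτ : τ ∈ Set.Ioo (0 : ℝ) 1) {lam μ : ℝ}
    (hl : 0 ≤ lam) (hμ : 0 ≤ μ) {p : ℝ≥0∞} (hp : 1 ≤ p) (z : Phase N) :
    expW ω lam (phaseNorm z) * ‖rihaczek f z‖ₑ ≤
      constD2 ω K p lam μ g * ENNReal.ofReal (Real.exp (2 * K * (K ^ 2 * lam + μ))) *
        wNormPhase ω (2 * K * (K ^ 2 * lam + μ)) (wig (1 - τ) (TimeFreq.reflect g)) 1 *
        wNormPhase ω (2 * K * (K ^ 2 * lam + μ)) (wig τ f) p := by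
  have hc : 0 ≤ K ^ 2 * lam + μ := by positivity
  have h1 := hf.rihaczek_le_stft hg hω hK hl
    (expW_mul_enorm_le_wNorm hω hg.continuous (K ^ 2 * lam))
    (expW_mul_enorm_le_wNorm hω hg.continuous_fourier (K ^ 2 * lam)) z
  have h2 := hf.stft_norm_sq_le hg hω hK hτ hc hp
  have hconj : (2 * p).HolderConjugate (ENNReal.conjExponent (2 * p)) :=
    .conjExponent (one_le_two_mul hp).le
  have hV := (continuous_stft hf.integrable hf.continuous hg.continuous hg.exists_bound)
  -- Hölder with exponents `(2p)'` and `2p` after writing `e^{K²λω} = e^{-μω} e^{(K²λ+μ)ω}`.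
  have h3 : ∫⁻ w : Phase N, expW ω (K ^ 2 * lam) (phaseNorm w) * ‖stft g f w‖ₑ ≤
      wNormPhase ω (-μ) (fun _ : Phase N => (1 : ℂ)) (ENNReal.conjExponent (2 * p)) *
        wNormPhase ω (K ^ 2 * lam + μ) (stft g f) (2 * p) := by
    have := hconj.symm
    have h4 := eLpNorm_smul_le_mul_eLpNorm (μ := (volume : Measure (Phase N))) (r := 1)
      (p := ENNReal.conjExponent (2 * p)) (q := 2 * p)
      (f := fun z : Phase N =>
        ((Real.exp ((K ^ 2 * lam + μ) * ω (phaseNorm z)) : ℝ) : ℂ) * stft g f z)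
      (φ := fun z : Phase N => ((Real.exp (-μ * ω (phaseNorm z)) : ℝ) : ℂ) * 1)
      ((continuous_weight_mul hω _).mul hV).aestronglyMeasurable
      ((continuous_weight_mul hω _).mul continuous_const).aestronglyMeasurable
    refine le_trans (le_of_eq ?_) h4
    rw [eLpNorm_one_eq_lintegral_enorm]
    congr 1
    ext w
    rw [Pi.smul_apply', smul_eq_mul, enorm_mul, enorm_exp_mul, enorm_exp_mul, enorm_one, mul_one,
      ← mul_assoc, ofReal_exp_mul, expW]
    congr 3
    ring
  obtain ⟨hD0, hDt⟩ := hg.constD2_denom hω hg0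
  rw [← eLpNorm_two_pow_four] at h1
  have h5 : expW ω lam (phaseNorm z) * ‖rihaczek f z‖ₑ ≤ constD2 ω K p lam μ g *
      wNormPhase ω (K ^ 2 * lam + μ) (stft g f) (2 * p) ^ 2 := by
    rw [constD2, ← ENNReal.mul_div_right_comm, ENNReal.le_div_iff_mul_le (.inl hD0) (.inl hDt),
      mul_comm]
    refine h1.trans ((mul_le_mul_right (pow_le_pow_left' h3 2) _).trans (le_of_eq ?_))
    ring
  refine h5.trans ((mul_le_mul_right h2 _).trans (le_of_eq ?_))
  ring

theorem measure_ge_of_rihaczek (hω : IsWeightFunction ω) (hK : CondAlpha ω K) {a b : ℝ}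
    (hb : CondGamma ω a b) (hfS : MemS ω f) (hf0 : f ≠ 0)
    (hτ : τ ∈ Set.Ioo (0 : ℝ) 1) {lam μ : ℝ} (hl : 0 ≤ lam) {E : Set (Phase N)}
    {p : ℝ≥0∞} (hp : 1 ≤ p)
    (hμ : 2 * (N : ℝ) / (b * (ENNReal.conjExponent (2 * p)).toReal) < μ) {c : ℝ≥0∞}
    (h : c * constD4 N ω K p τ lam μ * wNormPhase ω (2 * K * (K ^ 2 * lam + μ)) (wig τ f) p ≤
        wContent ω lam (rihaczek f) E) : c ≤ volume E := by
  have hf := hfS.rapidDecay hω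
  have hK0 : 0 ≤ K := zero_le_one.trans hK.1
  have hμ0 : 0 ≤ μ := by
    have := hb.1
    exact le_trans (by positivity) hμ.le
  have hs : 0 ≤ K ^ 2 * lam := by positivity
  have hc : 0 ≤ 2 * K * (K ^ 2 * lam + μ) := by positivity
  have hp0 : p ≠ 0 := (zero_lt_one.trans_le hp).ne'
  have hτ' : 1 - τ ∈ Set.Ioo (0 : ℝ) 1 := ⟨by linarith [hτ.2], by linarith [hτ.1]⟩
  have hWt : wNormPhase ω (2 * K * (K ^ 2 * lam + μ)) (wig τ f) p ≠ ∞ :=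
    (wNormPhase_lt_top hω (hf.wig_decay hω hτ) hc hp0).ne
  set W := wNormPhase ω (2 * K * (K ^ 2 * lam + μ)) (wig τ f) p
  have hD4 : constD4 N ω K p τ lam μ ≤ constD2 ω K p lam μ f *
      ENNReal.ofReal (Real.exp (2 * K * (K ^ 2 * lam + μ))) *
        wNormPhase ω (2 * K * (K ^ 2 * lam + μ)) (wig (1 - τ) (reflect f)) 1 :=
    iInf_le_of_le f (iInf_le_of_le hfS (iInf_le _ hf0))
  have hD2t : constD2 ω K p lam μ f ≠ ∞ := by
    refine ENNReal.div_ne_top ?_ (hf.constD2_denom hω hf0).1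
    refine ENNReal.mul_ne_top (ENNReal.mul_ne_top (ENNReal.mul_ne_top ENNReal.ofReal_ne_top
      (wNorm_top_lt_top (hf.decay _ hs)).ne) (wNorm_top_lt_top (hf.decay_fourier _ hs)).ne)
      (ENNReal.pow_ne_top (wNormPhase_neg_lt_top hω hb (conjExponent_ne_zero _)
        (conjExponent_two_mul_ne_top hp) hμ).ne)
  have hdft := ENNReal.mul_ne_top (ENNReal.mul_ne_top hD2t
    (ENNReal.ofReal_ne_top (r := Real.exp (2 * K * (K ^ 2 * lam + μ)))))
    (wNormPhase_lt_top hω (hf.reflect.wig_decay hω hτ') hc one_ne_zero).ne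
  obtain ⟨x, hx⟩ := Function.ne_iff.1 hf0
  obtain ⟨ξ, hξ⟩ := Function.ne_iff.1 (fourierT_ne_zero hf.integrable hf.continuous hf0)
  have hpos : expW ω lam (phaseNorm (x, ξ)) * ‖rihaczek f (x, ξ)‖ₑ ≠ 0 := by
    rw [enorm_rihaczek]
    refine mul_ne_zero (by simp [expW, Real.exp_pos]) (mul_ne_zero ?_ ?_)
    · simpa using hx
    · simpa using hξ
  -- If `W` vanished, the estimate with `g = f` would make `Rf` zero at a point where it is not.
  have hW0 : W ≠ 0 := fun h0 => hpos <| le_antisymm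
    ((hf.rihaczek_le_wig hf hf0 hω hK hτ hl hμ0 hp (x, ξ)).trans (by
      change _ * W ≤ 0
      rw [h0, mul_zero])) zero_le
  have hle : ∀ z, expW ω lam (phaseNorm z) * ‖rihaczek f z‖ₑ ≤ constD4 N ω K p τ lam μ * W :=
    fun z => by
    -- Dividing by `W`, nonzero and finite, lets the bound pass to the infimum over `g`.
    rw [← ENNReal.div_le_iff hW0 hWt, constD4]
    refine le_iInf fun g => le_iInf fun hg => le_iInf fun hg0 => ?_
    rw [ENNReal.div_le_iff hW0 hWt]
    exact hf.rihaczek_le_wig (hg.rapidDecay hω) hg0 hω hK hτ hl hμ0 hp z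
  refine le_measure_of_le_wContent hle (fun h0 => hpos ?_)
    (ENNReal.mul_ne_top (ne_top_of_le_ne_top hdft hD4) hWt) (by rwa [mul_assoc] at h)
  exact le_antisymm (h0 ▸ hle (x, ξ)) zero_le

end Main

end TimeFreq
end

theorem mainTheorem8 (N : ℕ) (ω : ℝ → ℝ) (hω : TimeFreq.IsWeightFunction ω)
    (K : ℝ) (hK : TimeFreq.CondAlpha ω K) (a b : ℝ) (hb : TimeFreq.CondGamma ω a b)
    (E : Set (TimeFreq.Phase N)) (hE : NullMeasurableSet E volume)
    (p : ℝ≥0∞) (hp : 1 ≤ p) (τ : ℝ) (hτ : τ ∈ Set.Ioo (0 : ℝ) 1)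
    (ε : ℝ) (hε : ε ∈ Set.Ioo (0 : ℝ) 1)
    (h :
      (∃ f : TimeFreq.RN N → ℂ, TimeFreq.MemS ω f ∧ f ≠ 0 ∧ ∃ lam : ℝ, 0 ≤ lam ∧
        ENNReal.ofReal (1 - ε) * ENNReal.ofReal (Real.sqrt (TimeFreq.constD3 N K τ lam)) *
            TimeFreq.wNormPhase ω (4 * K ^ 2 * lam) (TimeFreq.rihaczek f) p ^ (1 / 2 : ℝ) *
            TimeFreq.wNormPhase ω (4 * K ^ 2 * lam) (TimeFreq.rihaczek f)
              (ENNReal.conjExponent p) ^ (1 / 2 : ℝ) ≤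
          TimeFreq.wContent ω lam (TimeFreq.wig τ f) E) ∨
      (∃ f : TimeFreq.RN N → ℂ, TimeFreq.MemS ω f ∧ f ≠ 0 ∧ ∃ lam μ : ℝ, 0 ≤ lam ∧
        2 * (N : ℝ) / (b * (ENNReal.conjExponent (2 * p)).toReal) < μ ∧
        ENNReal.ofReal (1 - ε) * TimeFreq.constD4 N ω K p τ lam μ *
            TimeFreq.wNormPhase ω (2 * K * (K ^ 2 * lam + μ)) (TimeFreq.wig τ f) p ≤
          TimeFreq.wContent ω lam (TimeFreq.rihaczek f) E)) :
    ENNReal.ofReal (1 - ε) ≤ volume E := by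
  rcases h with ⟨f, hf, hf0, lam, hl, h⟩ | ⟨f, hf, hf0, lam, μ, hl, hμ, h⟩
  · exact TimeFreq.measure_ge_of_wig hω hK (hf.rapidDecay hω) hf0 hτ hl hp h
  · exact TimeFreq.measure_ge_of_rihaczek hω hK hb hf hf0 hτ hl hp hμ h
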